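/- **Regret for online hinge loss.** Fix integers $d,T\ge 1$, a bound $C>0$, a threshold $\theta>0$ and gravities $g^{(1)},\dots,g^{(T)}\ge 0$ with $g^{(t)}\le g_{\max}$, and put $\eta=\frac{1}{C^2\sqrt T}$. For $\alpha\ge 0$ let $\mathcal T(v,\alpha,\theta)=\max\{v-\alpha,0\}$ if $0\le v\le\theta$, $\mathcal T(v,\alpha,\theta)=\min\{v+\alpha,0\}$ if $-\theta\le v\le 0$, and $\mathcal T(v,\alpha,\theta)=v$ otherwise. Let $x^{(t)}\in\mathbb R^d$ with $\|x^{(t)}\|_2\le C$ and $y^{(t)}\in\{\pm1\}$ be the examples and labels, and let $\tilde y^{(t)}\in\mathbb R$ be estimated predictions. The weight vectors are $w^{(1)}=0$ and $$w^{(t+1)}_j=\begin{cases}\mathcal T\big(w^{(t)}_j+\eta\,y^{(t)}x^{(t)}_j,\;g^{(t)}\eta,\;\theta\big)&\text{if }y^{(t)}\tilde y^{(t)}<1,\\ \mathcal T\big(w^{(t)}_j,\;g^{(t)}\eta,\;\theta\big)&\text{otherwise.}\end{cases}$$ For $u,w\in\mathbb R^d$ let $u\cdot I(|w|\le\theta)$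 be the vector obtained from $u$ by replacing $u_j$ by $0$ whenever $|w_j|>\theta$. (a) Suppose that for every $t\in\{1,\dots,T\}$ the number $\tilde y^{(t)}$ is within $\epsilon_{\rm IP}=\frac1{2\sqrt T}$ of $w^{(t)}\cdot x^{(t)}$, and $\tilde q^{(t+1)}$ is within $\frac1{2\eta T}=\frac{C^2}{2\sqrt T}$ of $\big\|w^{(t+1)}\cdot I(|w^{(t+1)}|\le\theta)\big\|_1$. Then for every $u\in\mathbb R^d$ (in particular for the best fixed strategy $u^*$ in hindsight) $$\frac1T\sum_{t=1}^T\big(1-y^{(t)}\tilde y^{(t)}\big)^++\frac1T\sum_{t=1}^T g^{(t)}\tilde q^{(t+1)}-\frac1T\sum_{t=1}^T\big(1-y^{(t)}u^Tx^{(t)}\big)^+-\frac1T\sum_{t=1}^T g^{(t)}\big\|u\cdot I(|w^{(t+1)}|\le\theta)\big\|_1\le\frac{2+C^2\big(g_{\max}+\|u\|_2^2\big)}{2\sqrt T}.$$ (b) Let the gravity be constant, $g^{(1)}=\dots=g^{(T)}=g=g_{\max}>0$. There is a constant $K$, depending only on $C$, $g$ and $\theta$, such that for all $d\ge1$, $T\ge2$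 and $\delta\in(0,1)$ there is a quantum algorithm that works as follows. In round $t$ it has quantum query access to $x^{(1)},\dots,x^{(t)}$, through the unitaries $|j\rangle|z\rangle\mapsto|j\rangle|z+x^{(s)}_j\rangle$ ($s\le t$) and their inverses, in exact real arithmetic; it outputs $\tilde y^{(t)}$ (with $\tilde y^{(1)}=0$), then receives $y^{(t)}$, prepares the state $|w^{(t+1)}\rangle=\sum_j\sqrt{|w^{(t+1)}_j|/\|w^{(t+1)}\|_1}\,|j\rangle$ (if $w^{(t+1)}\neq0$), and outputs $\tilde q^{(t+1)}$. For all examples with $\|x^{(t)}\|_2\le C$ and all labels in $\{\pm1\}$, even if chosen adaptively depending on the numbers reported so far, it makes at most $K\,T^{5/2}\sqrt d\,\log\frac T\delta$ queries, and with probability at least $1-\delta$ the following hold together: every $\tilde y^{(t)}$ is within $\epsilon_{\rm IP}=\frac1{2\sqrt T}$ of $w^{(t)}\cdot x^{(t)}$; every $\tilde q^{(t+1)}$ is within $\epsilon_{\rm norm}=\min\big\{\frac1{2\sqrt T},\frac1{2\eta T}\big\}$ of $\big\|w^{(t+1)}\cdot I(|w^{(t+1)}|\le\theta)\big\|_1$;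 all the states are prepared; and the regret bound in (a) holds for every $u\in\mathbb R^d$. -/

import Mathlib

open scoped ENNReal

noncomputable section

namespace SparseOnline

/-! ### Truncated gradient descent for the hinge loss

Rounds are numbered `0, 1, …, T - 1`; the weight vector used in round `t` is `weight … t`, so that
`weight … 0 = 0` is the initial one and `weight … (t + 1)` results from the update of round `t`. -/

/-- The truncation of a real number `v` with gravity `α` and threshold `θ`. -/
def trunc (v α θ : ℝ) : ℝ :=
  if 0 ≤ v ∧ v ≤ θ then max (v - α) 0
  else if -θ ≤ v ∧ v ≤ 0 then min (v + α) 0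
  else v

/-- The hinge-loss update of one round: a step `η • y • x` if `y * ytil < 1` and no step otherwise,
where `ytil` is the estimated prediction, followed by coordinatewise truncation with
gravity `g * η` and threshold `θ`. -/
def hingeStep {d : ℕ} (η θ g : ℝ) (w x : EuclideanSpace ℝ (Fin d)) (y ytil : ℝ) :
    EuclideanSpace ℝ (Fin d) :=
  WithLp.toLp 2 fun j =>
    trunc (if y * ytil < 1 then w j + η * y * x j else w j) (g * η) θ

/-- The weight vectors produced from the examples `x`, the labels `y` and the estimated
predictions `ytil`. -/
def weight {d : ℕ} (η θ : ℝ) (g : ℕ → ℝ) (x : ℕ → EuclideanSpace ℝ (Fin d)) (y ytil : ℕ → ℝ) :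
    ℕ → EuclideanSpace ℝ (Fin d)
  | 0 => 0
  | t + 1 => hingeStep η θ (g t) (weight η θ g x y ytil t) (x t) (y t) (ytil t)

/-- The inner product `w · x`. -/
def dot {d : ℕ} (w x : EuclideanSpace ℝ (Fin d)) : ℝ := ∑ j, w j * x j

/-- `‖u · I(|w| ≤ θ)‖₁`: the `ℓ₁`-norm of `u` restricted to the coordinates with `|w j| ≤ θ`. -/
def maskedNorm {d : ℕ} (θ : ℝ) (u w : EuclideanSpace ℝ (Fin d)) : ℝ :=
  ∑ j, if |w j| ≤ θ then |u j| else 0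

/-- In each of the first `T` rounds, `ytil t` is within `εIP` of the prediction `w^(t) · x^(t)`, and
`qtil t` is within `εnorm` of `‖w^(t+1) · I(|w^(t+1)| ≤ θ)‖₁`. -/
def Accurate {d : ℕ} (T : ℕ) (η θ : ℝ) (g : ℕ → ℝ) (x : ℕ → EuclideanSpace ℝ (Fin d))
    (y ytil qtil : ℕ → ℝ) (εIP εnorm : ℝ) : Prop :=
  ∀ t < T,
    |ytil t - dot (weight η θ g x y ytil t) (x t)| ≤ εIP ∧
    |qtil t - maskedNorm θ (weight η θ g x y ytil (t + 1)) (weight η θ g x y ytil (t + 1))| ≤ εnorm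

/-- The (per-step, regularised) hinge-loss regret against the comparator `u`; `qtil t` is the
estimate obtained in round `t` for the weight vector with index `t + 1`. -/
def hingeRegret {d : ℕ} (T : ℕ) (η θ : ℝ) (g : ℕ → ℝ) (x : ℕ → EuclideanSpace ℝ (Fin d))
    (y ytil qtil : ℕ → ℝ) (u : EuclideanSpace ℝ (Fin d)) : ℝ :=
  (1 / (T : ℝ)) * ∑ t ∈ Finset.range T, max (1 - y t * ytil t) 0
    + (1 / (T : ℝ)) * ∑ t ∈ Finset.range T, g t * qtil t
    - (1 / (T : ℝ)) * ∑ t ∈ Finset.range T, max (1 - y t * dot u (x t)) 0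
    - (1 / (T : ℝ)) * ∑ t ∈ Finset.range T,
        g t * maskedNorm θ u (weight η θ g x y ytil (t + 1))

/-! ### Quantum states and queries

The computational basis consists of the states `|j⟩|z⟩|ω⟩` with an index `j`, a real
number `z` in the value register (exact quantum arithmetic), and a workspace label `ω`. -/

/-- Labels of the computational basis. -/
abbrev Label (d : ℕ) (W : Type) : Type := Fin d × ℝ × W

/-- The Hilbert space `ℓ²` over the computational basis. -/
abbrev State (d : ℕ) (W : Type) : Type := lp (fun _ : Label d W => ℂ) 2

/-- The permutation of the basis underlying a query to `u`: `|j⟩|z⟩|ω⟩ ↦ |j⟩|z + u j⟩|ω⟩`. -/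
def queryPerm {d : ℕ} (W : Type) (u : EuclideanSpace ℝ (Fin d)) :
    Equiv.Perm (Label d W) where
  toFun b := (b.1, b.2.1 + u b.1, b.2.2)
  invFun b := (b.1, b.2.1 - u b.1, b.2.2)
  left_inv b := by simp
  right_inv b := by simp

/-- The unitary that permutes basis states by `e`: it maps `|b⟩` to `|e b⟩`. -/
def permute {d : ℕ} {W : Type} (e : Equiv.Perm (Label d W)) (ψ : State d W) : State d W :=
  ⟨fun b => ψ (e.symm b), by
    have h : Summable fun b => ‖ψ b‖ ^ (2 : ℝ≥0∞).toReal :=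
      (lp.memℓp ψ).summable (by norm_num)
    exact memℓp_gen (h.comp_injective e.symm.injective)⟩

/-- The (unnormalised) projection of a state onto the span of the basis states `b` with
`m b = o`: the branch in which the measurement of `m` has outcome `o`. -/
def collapse {d : ℕ} {W O : Type} (m : Label d W → O) (o : O) (ψ : State d W) : State d W :=
  ⟨Set.indicator {b | m b = o} ψ, by
    refine Memℓp.mono' (lp.memℓp ψ) fun b => ?_
    by_cases h : m b = o <;> simp [h]⟩

/-- Gates of a circuit that has access to the oracles of `n` examples: an arbitrary unitary that
does not depend on the examples, a query to the oracle of example `s`, or a query to its inverse. -/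
inductive Gate (d : ℕ) (W : Type) (n : ℕ) : Type
  | unitary (U : State d W ≃ₗᵢ[ℂ] State d W)
  | query (s : Fin n)
  | queryInv (s : Fin n)

/-- The action of a gate, with oracles for the vectors `x s`. -/
def Gate.apply {d n : ℕ} {W : Type} (x : ℕ → EuclideanSpace ℝ (Fin d)) :
    Gate d W n → State d W → State d W
  | .unitary U => fun ψ => U ψ
  | .query s => permute (queryPerm W (x s))
  | .queryInv s => permute (queryPerm W (x s)).symm

/-- The number of queries of a gate. -/
def Gate.cost {d n : ℕ} {W : Type} : Gate d W n → ℕ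
  | .unitary _ => 0
  | .query _ => 1
  | .queryInv _ => 1

/-- A circuit is a list of gates, the first gate being applied first. -/
abbrev Circuit (d : ℕ) (W : Type) (n : ℕ) : Type := List (Gate d W n)

/-- The action of a circuit. -/
def Circuit.apply {d n : ℕ} {W : Type} (x : ℕ → EuclideanSpace ℝ (Fin d)) (c : Circuit d W n)
    (ψ : State d W) : State d W :=
  c.foldl (fun φ G => G.apply x φ) ψ

/-- The number of queries of a circuit. -/
def Circuit.cost {d n : ℕ} {W : Type} (c : Circuit d W n) : ℕ := (c.map Gate.cost).sum

/-! ### Quantum online learners -/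

/-- A measurement outcome: the reported real number, and further classical data to be remembered. -/
abbrev Outcome (M : Type) : Type := ℝ × M

/-- The classical data of one completed round that a learner sees: the outcome of the prediction
phase, the true label, and the outcome of the estimation phase. -/
abbrev Record (M : Type) : Type := Outcome M × ℝ × Outcome M

/-- A quantum online learner. In round `t` it has oracle access to the examples `0, …, t` and knows
the records of the earlier rounds. It runs a circuit and measures, reporting the
prediction; then it receives the label, runs a second circuit and measures again, reporting
the norm estimate. The quantum state is kept between the phases and between the rounds. -/
structure Learner (d : ℕ) (W M : Type) where
  init : State d W
  norm_init : ‖init‖ = 1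
  predCircuit : (t : ℕ) → (Fin t → Record M) → Circuit d W (t + 1)
  predMeas : (t : ℕ) → (Fin t → Record M) → Label d W → Outcome M
  estCircuit : (t : ℕ) → (Fin t → Record M) → Outcome M → ℝ → Circuit d W (t + 1)
  estMeas : (t : ℕ) → (Fin t → Record M) → Outcome M → ℝ → Label d W → Outcome M

/-- An (adaptive) adversary: the example of round `t` may depend on the pairs of numbers reported in
the earlier rounds, and its label moreover on the prediction reported in round `t`. -/
structure Adversary (d : ℕ) where
  point : (t : ℕ) → (Fin t → ℝ × ℝ) → EuclideanSpace ℝ (Fin d)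
  label : (t : ℕ) → (Fin t → ℝ × ℝ) → ℝ → ℝ

/-- The examples have Euclidean norm at most `C`, and the labels are `1` or `-1`. -/
def Adversary.Admissible {d : ℕ} (E : Adversary d) (C : ℝ) : Prop :=
  (∀ t r, ‖E.point t r‖ ≤ C) ∧ ∀ t r p, E.label t r p = 1 ∨ E.label t r p = -1

/-- The two measurement outcomes of every round. -/
abbrev Transcript (M : Type) : Type := ℕ → Outcome M × Outcome M

section Run

variable {d : ℕ} {W M : Type}

/-- The prediction reported in round `t`. -/
def Transcript.pred (τ : Transcript M) (t : ℕ) : ℝ := (τ t).1.1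

/-- The norm estimate reported in round `t`. -/
def Transcript.est (τ : Transcript M) (t : ℕ) : ℝ := (τ t).2.1

/-- The numbers reported before round `t`. -/
def Transcript.reports (τ : Transcript M) (t : ℕ) : Fin t → ℝ × ℝ :=
  fun i => (τ.pred i, τ.est i)

/-- The example of round `t`. -/
def Adversary.x (E : Adversary d) (τ : Transcript M) (t : ℕ) : EuclideanSpace ℝ (Fin d) :=
  E.point t (τ.reports t)

/-- The label of round `t`. -/
def Adversary.y (E : Adversary d) (τ : Transcript M) (t : ℕ) : ℝ :=
  E.label t (τ.reports t) (τ.pred t)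

/-- The records of the rounds before round `t`. -/
def records (E : Adversary d) (τ : Transcript M) (t : ℕ) : Fin t → Record M :=
  fun i => ((τ i).1, E.y τ i, (τ i).2)

/-- The unnormalised state before round `t`, in the branch where the measurement outcomes are those
of `τ`. Its squared norm is the probability of the outcomes of the first `t` rounds. -/
def Learner.branch (A : Learner d W M) (E : Adversary d) (τ : Transcript M) : ℕ → State d W
  | 0 => A.init
  | t + 1 =>
    let past := records E τ t
    let ψ := collapse (A.predMeas t past) (τ t).1
      ((A.predCircuit t past).apply (E.x τ) (A.branch E τ t))
    collapse (A.estMeas t past (τ t).1 (E.y τ t)) (τ t).2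
      ((A.estCircuit t past (τ t).1 (E.y τ t)).apply (E.x τ) ψ)

/-- The total number of queries in the first `T` rounds along `τ`. -/
def Learner.queries (A : Learner d W M) (E : Adversary d) (τ : Transcript M) (T : ℕ) : ℕ :=
  ∑ t ∈ Finset.range T,
    ((A.predCircuit t (records E τ t)).cost
      + (A.estCircuit t (records E τ t) (τ t).1 (E.y τ t)).cost)

/-- Extend the outcomes of `T` rounds by an arbitrary (irrelevant) outcome. -/
def extend [Inhabited M] {T : ℕ} (τ : Fin T → Outcome M × Outcome M) : Transcript M :=
  fun t => if h : t < T then τ ⟨t, h⟩ else default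

/-- The probability that the transcript of the first `T` rounds satisfies `P`. -/
def Learner.prob [Inhabited M] (A : Learner d W M) (E : Adversary d) (T : ℕ)
    (P : Transcript M → Prop) : ℝ≥0∞ :=
  ∑' τ : {τ : Fin T → Outcome M × Outcome M // P (extend τ)},
    ‖A.branch E (extend τ.1) T‖ₑ ^ 2

/-- The index register of `ψ` is, unentangled with the other registers, in the state
`|w⟩ = ∑ j, √(|w j| / ‖w‖₁) |j⟩`. -/
def Prepared (ψ : State d W) (w : EuclideanSpace ℝ (Fin d)) : Prop :=
  ∃ φ : ℝ → W → ℂ, ∀ j z ω,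
    ψ (j, z, ω) = ((Real.sqrt (|w j| / ∑ i, |w i|) : ℝ) : ℂ) * φ z ω

/-- The learner has carried out the sparse online learning algorithm with the hinge-loss update
along `τ`: the first prediction is `0`, all predictions and norm estimates are accurate, and every
round ends with the state `|w⟩` of the new weight vector in the index register (if that vector
is not zero, so that the state exists). -/
def Learner.Correct (A : Learner d W M) (E : Adversary d) (T : ℕ) (η θ g εIP εnorm : ℝ)
    (τ : Transcript M) : Prop :=
  τ.pred 0 = 0 ∧
  Accurate T η θ (fun _ => g) (E.x τ) (E.y τ) τ.pred τ.est εIP εnorm ∧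
  ∀ t < T,
    weight η θ (fun _ => g) (E.x τ) (E.y τ) τ.pred (t + 1) ≠ 0 →
      Prepared (A.branch E τ (t + 1))
        (weight η θ (fun _ => g) (E.x τ) (E.y τ) τ.pred (t + 1))

end Run

end SparseOnline

end

/-! Regret. Where the new weight stays within `θ`, truncation is the proximal step of `α * |·|`;
elsewhere it is the identity. Per coordinate this gives the inequality `sq_sub_trunc_le`, whose
penalties on both sides are switched on by the same new weight. Summed over coordinates and combined
with the expansion of the gradient step, it bounds one round by the drop of `‖u - w‖ ^ 2` plus error
terms (`hinge_round_le`). The drops telescope, and the choice of `η` balances the rest.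

Algorithm. Fix `c ≤ g` with `η * c ≤ θ`. A coordinate with zero weight and `|x j| ≤ c` moves by at
most `η * c`, and the gravity pulls it back to zero (`hingeStep_apply_eq_zero`). So only the support
of `w` and the coordinates with `|x j| > c` influence a round. There are at most `m = ⌈C ^ 2 / c ^
2⌉₊` of the latter, hence the support grows by at most `m` per round, and at most `r = m * T`
coordinates ever matter at once, independently of `d`.

Grover search with about `√(d / (8 r))` iterations yields each of them with probability at least `1
/ (8 r)` (`le_sq_groverAmp`). The learner runs `k` such searches coherently in separate slots. The
joint state is a product, so measuring it gives `k` independent samples, and a union bound shows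
that with `k` of order `r * log (r T / δ)` some coordinate is missed with probability at most `δ /
T` (`one_sub_le_sum_prod`, `miss_probability_le`). If none is missed, the prediction, the update and
the norm are computed classically and exactly, so the accuracy requirements hold with error zero.
The measured basis state is then rotated to `|w⟩` without queries. `Learner.pow_le_prob` multiplies
the conditional success probabilities over the rounds. -/

noncomputable section

namespace SparseOnline

/-! ### The regret bound -/

/-- Truncation is a proximal step below the threshold and the identity above it. -/
theorem sq_sub_trunc_le {θ α : ℝ} (hα : 0 ≤ α) (hθ : 0 < θ) (v u : ℝ) :
    (u - trunc v α θ) ^ 2 + 2 * α * (if |trunc v α θ| ≤ θ then |trunc v α θ| else 0)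
      ≤ (u - v) ^ 2 + 2 * α * (if |trunc v α θ| ≤ θ then |u| else 0) := by
  have hu1 : u ≤ |u| := le_abs_self u
  have hu2 : -u ≤ |u| := neg_le_abs u
  have hu0 : 0 ≤ |u| := abs_nonneg u
  unfold trunc
  split_ifs with h1 h2 h3 h4 h5
  · rcases le_total (v - α) 0 with h | h
    · rw [max_eq_right h]; simp only [abs_zero]; nlinarith
    · rw [max_eq_left h, abs_of_nonneg h]; nlinarith
  · exact absurd (by rw [abs_of_nonneg (le_max_right _ _)]; exact max_le (by linarith) hθ.le) h2
  · rcases le_total (v + α) 0 with h | h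
    · rw [min_eq_left h, abs_of_nonpos h]; nlinarith
    · rw [min_eq_right h]; simp only [abs_zero]; nlinarith
  · refine absurd ?_ h4
    rw [abs_of_nonpos (min_le_right _ _)]
    rcases le_total (v + α) 0 with h | h
    · rw [min_eq_left h]; linarith
    · rw [min_eq_right h]; linarith
  · exfalso
    have := abs_le.1 h5
    rcases le_total 0 v with h | h
    · exact h1 ⟨h, this.2⟩
    · exact h3 ⟨this.1, h⟩
  · simp

theorem norm_sq_sub_eq_sum {d : ℕ} (u w : EuclideanSpace ℝ (Fin d)) :
    ‖u - w‖ ^ 2 = ∑ j, (u j - w j) ^ 2 := by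
  simp [EuclideanSpace.real_norm_sq_eq]

theorem sq_sub_hingeStep_le {d : ℕ} {η θ g : ℝ} (hη : 0 < η) (hθ : 0 < θ) (hg : 0 ≤ g)
    (u w x : EuclideanSpace ℝ (Fin d)) (y ytil : ℝ) :
    ‖u - hingeStep η θ g w x y ytil‖ ^ 2 + 2 * (g * η) *
        maskedNorm θ (hingeStep η θ g w x y ytil) (hingeStep η θ g w x y ytil)
      ≤ ∑ j, (u j - if y * ytil < 1 then w j + η * y * x j else w j) ^ 2 + 2 * (g * η) *
        maskedNorm θ u (hingeStep η θ g w x y ytil) := by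
  rw [norm_sq_sub_eq_sum]
  unfold maskedNorm
  rw [Finset.mul_sum, Finset.mul_sum, ← Finset.sum_add_distrib, ← Finset.sum_add_distrib]
  exact Finset.sum_le_sum fun j _ => sq_sub_trunc_le (by positivity) hθ _ _

/-- The estimate `ytil` itself decides whether a step is made. If it is made, the reported loss is
exactly `1 - y * ytil`, and replacing `ytil` by `dot w x` costs at most `ε`. If not, the reported
loss is zero and the proximal inequality alone suffices. -/
theorem hinge_round_le {d : ℕ} {η θ g C ε : ℝ} (hη : 0 < η) (hθ : 0 < θ) (hg : 0 ≤ g)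
    (hε : 0 ≤ ε)
    (u w x : EuclideanSpace ℝ (Fin d)) {y ytil : ℝ} (hx : ‖x‖ ≤ C) (hy : y = 1 ∨ y = -1)
    (hyt : |ytil - dot w x| ≤ ε) :
    2 * η * (max (1 - y * ytil) 0 - max (1 - y * dot u x) 0
        + g * maskedNorm θ (hingeStep η θ g w x y ytil) (hingeStep η θ g w x y ytil)
        - g * maskedNorm θ u (hingeStep η θ g w x y ytil))
      ≤ ‖u - w‖ ^ 2 - ‖u - hingeStep η θ g w x y ytil‖ ^ 2 + η ^ 2 * C ^ 2 + 2 * η * ε := by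
  have key := sq_sub_hingeStep_le hη hθ hg u w x y ytil
  have hl : 1 - y * dot u x ≤ max (1 - y * dot u x) 0 := le_max_left _ _
  have hl0 : 0 ≤ max (1 - y * dot u x) 0 := le_max_right _ _
  by_cases h : y * ytil < 1
  · simp only [h, if_true] at key
    have hexp : ∑ j, (u j - (w j + η * y * x j)) ^ 2
        = ‖u - w‖ ^ 2 - 2 * η * (y * (dot u x - dot w x)) + η ^ 2 * ‖x‖ ^ 2 := by
      rw [norm_sq_sub_eq_sum, EuclideanSpace.real_norm_sq_eq, dot, dot, ← Finset.sum_sub_distrib,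
        Finset.mul_sum, Finset.mul_sum, Finset.mul_sum, ← Finset.sum_sub_distrib,
        ← Finset.sum_add_distrib]
      refine Finset.sum_congr rfl fun j _ => ?_
      have : y ^ 2 = 1 := by rcases hy with rfl | rfl <;> norm_num
      linear_combination η ^ 2 * (x j) ^ 2 * this
    have hx2 : ‖x‖ ^ 2 ≤ C ^ 2 := by gcongr
    have hyy : y * (dot w x - ytil) ≤ ε := by
      have := abs_le.1 hyt
      rcases hy with rfl | rfl <;> linarith
    rw [max_eq_left (by linarith : (0 : ℝ) ≤ 1 - y * ytil)]
    have e1 : 2 * η * (1 - y * ytil - max (1 - y * dot u x) 0)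
        ≤ 2 * η * (y * (dot u x - dot w x) + ε) :=
      mul_le_mul_of_nonneg_left (by linarith) (by positivity)
    have e2 : η ^ 2 * ‖x‖ ^ 2 ≤ η ^ 2 * C ^ 2 := by gcongr
    linarith
  · simp only [h, if_false, ← norm_sq_sub_eq_sum] at key
    rw [max_eq_right (by linarith : 1 - y * ytil ≤ 0)]
    have e1 : 0 ≤ 2 * η * max (1 - y * dot u x) 0 := by positivity
    have e2 : 0 ≤ η ^ 2 * C ^ 2 := by positivity
    have e3 : 0 ≤ 2 * η * ε := by positivity
    linarith

theorem hingeRegret_le {C θ : ℝ} {d T : ℕ} {g : ℕ → ℝ} {gmax η : ℝ}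
    {x : ℕ → EuclideanSpace ℝ (Fin d)} {y ytil qtil : ℕ → ℝ}
    (hC : 0 < C) (hθ : 0 < θ) (hT : 1 ≤ T) (hη : η = 1 / (C ^ 2 * Real.sqrt T))
    (hg : ∀ t < T, 0 ≤ g t ∧ g t ≤ gmax) (hx : ∀ t < T, ‖x t‖ ≤ C)
    (hy : ∀ t < T, y t = 1 ∨ y t = -1)
    (hacc : Accurate T η θ g x y ytil qtil (1 / (2 * Real.sqrt T)) (1 / (2 * η * T)))
    (u : EuclideanSpace ℝ (Fin d)) :
    hingeRegret T η θ g x y ytil qtil u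
      ≤ (2 + C ^ 2 * (gmax + ‖u‖ ^ 2)) / (2 * Real.sqrt T) := by
  have hT0 : (0 : ℝ) < T := by exact_mod_cast hT
  obtain ⟨s, hs⟩ : ∃ s, s = Real.sqrt T := ⟨_, rfl⟩
  have hs0 : 0 < s := by rw [hs]; positivity
  have hsq : (T : ℝ) = s ^ 2 := by rw [hs, Real.sq_sqrt hT0.le]
  rw [← hs] at hη hacc ⊢
  have hη0 : 0 < η := by rw [hη]; positivity
  set w := weight η θ g x y ytil with hw
  have hround : ∀ t < T, max (1 - y t * ytil t) 0 + g t * qtil t - max (1 - y t * dot u (x t)) 0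
      - g t * maskedNorm θ u (w (t + 1))
      ≤ (‖u - w t‖ ^ 2 - ‖u - w (t + 1)‖ ^ 2) / (2 * η) + η * C ^ 2 / 2 + 1 / (2 * s)
        + gmax * (1 / (2 * η * T)) := by
    intro t ht
    obtain ⟨h1, h2⟩ := hacc t ht
    have hr := hinge_round_le hη0 hθ (hg t ht).1 (by positivity : 0 ≤ 1 / (2 * s)) u (w t) (x t)
      (hx t ht) (hy t ht) h1
    have hq : g t * qtil t ≤ g t * maskedNorm θ (w (t + 1)) (w (t + 1))
        + gmax * (1 / (2 * η * T)) := by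
      have h3 := (abs_le.1 h2).2
      have h4 : g t * (qtil t - maskedNorm θ (w (t + 1)) (w (t + 1))) ≤ g t * (1 / (2 * η * T)) :=
        mul_le_mul_of_nonneg_left h3 (hg t ht).1
      have h5 : g t * (1 / (2 * η * T)) ≤ gmax * (1 / (2 * η * T)) :=
        mul_le_mul_of_nonneg_right (hg t ht).2 (by positivity)
      linarith
    change 2 * η * (_ - _ + g t * maskedNorm θ (w (t + 1)) (w (t + 1))
      - g t * maskedNorm θ u (w (t + 1))) ≤ ‖u - w t‖ ^ 2 - ‖u - w (t + 1)‖ ^ 2 + _ + _ at hr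
    rw [← le_div_iff₀' (by positivity)] at hr
    have : (‖u - w t‖ ^ 2 - ‖u - w (t + 1)‖ ^ 2 + η ^ 2 * C ^ 2 + 2 * η * (1 / (2 * s))) / (2 * η)
        = (‖u - w t‖ ^ 2 - ‖u - w (t + 1)‖ ^ 2) / (2 * η) + η * C ^ 2 / 2 + 1 / (2 * s) := by
      field_simp
    linarith
  have hsum := Finset.sum_le_sum fun t (ht : t ∈ Finset.range T) =>
    hround t (Finset.mem_range.1 ht)
  have htel : ∑ t ∈ Finset.range T, (‖u - w t‖ ^ 2 - ‖u - w (t + 1)‖ ^ 2) / (2 * η)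
      ≤ ‖u‖ ^ 2 / (2 * η) := by
    rw [← Finset.sum_div, Finset.sum_range_sub']
    have : w 0 = 0 := rfl
    rw [this, sub_zero]
    gcongr
    linarith [sq_nonneg ‖u - w T‖]
  simp only [Finset.sum_add_distrib, Finset.sum_sub_distrib, Finset.sum_const, Finset.card_range,
    nsmul_eq_mul] at hsum
  have hreg : hingeRegret T η θ g x y ytil qtil u = (1 / (T : ℝ)) *
      (∑ t ∈ Finset.range T, max (1 - y t * ytil t) 0 + ∑ t ∈ Finset.range T, g t * qtil t
      - ∑ t ∈ Finset.range T, max (1 - y t * dot u (x t)) 0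
      - ∑ t ∈ Finset.range T, g t * maskedNorm θ u (w (t + 1))) := by
    rw [hingeRegret]; ring
  rw [hreg]
  -- Each term becomes a multiple of `1 / (2 * s)`: `C ^ 2 * ‖u‖ ^ 2` from the initial distance, `1`
  -- from the squared step lengths, `1` from the prediction errors and `C ^ 2 * gmax` from the norm
  -- estimates.
  have hfin : (1 / (T : ℝ)) * (‖u‖ ^ 2 / (2 * η) + T * (η * C ^ 2 / 2) + T * (1 / (2 * s))
      + T * (gmax * (1 / (2 * η * T)))) = (2 + C ^ 2 * (gmax + ‖u‖ ^ 2)) / (2 * s) := by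
    rw [hη, hsq]; field_simp; ring
  rw [← hfin]
  gcongr
  linarith

/-! ### Unitaries -/

/-- Any unit vector can be mapped to any other one, up to a phase, by a unitary. -/
theorem exists_unitary_apply_eq_smul {E : Type*} [NormedAddCommGroup E] [InnerProductSpace ℂ E]
    {a b : E} (ha : ‖a‖ = 1) (hb : ‖b‖ = 1) :
    ∃ (U : E ≃ₗᵢ[ℂ] E) (c : ℂ), ‖c‖ = 1 ∧ U a = c • b := by
  -- A reflection can exchange two unit vectors only if their inner product is real; the phase `c`
  -- achieves this.
  obtain ⟨c, hc, hcr⟩ : ∃ c : ℂ, ‖c‖ = 1 ∧ inner ℂ (c • b) a = (‖inner ℂ b a‖ : ℂ) := by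
    by_cases hz : inner ℂ b a = 0
    · exact ⟨1, by simp, by simp [hz]⟩
    · refine ⟨inner ℂ b a / ‖inner ℂ b a‖, by simp [hz], ?_⟩
      have hz' : (‖inner ℂ b a‖ : ℂ) ≠ 0 := by simpa using hz
      rw [inner_smul_left, map_div₀, Complex.conj_ofReal, div_mul_eq_mul_div,
        ← Complex.normSq_eq_conj_mul_self, Complex.normSq_eq_norm_sq]
      field_simp
      push_cast
      ring
  set b' := c • b with hb'
  have hb1 : ‖b'‖ = 1 := by rw [hb', norm_smul, hc, hb, one_mul]
  set ρ := ‖inner ℂ b a‖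
  have hcr' : inner ℂ a b' = (ρ : ℂ) := by
    rw [← inner_conj_symm, hcr, Complex.conj_ofReal]
  by_cases hv : a - b' = 0
  · exact ⟨LinearIsometryEquiv.refl ℂ E, c, hc, by simpa using sub_eq_zero.1 hv⟩
  -- The negated reflection in the line through `a - b'` is the Householder reflection in its
  -- orthogonal hyperplane.
  refine ⟨(Submodule.reflection (ℂ ∙ (a - b'))).trans (LinearIsometryEquiv.neg ℂ), c, hc, ?_⟩
  have hn : ((‖a - b'‖ : ℂ)) ^ 2 = 2 * (1 - ρ) := by
    refine (inner_self_eq_norm_sq_to_K (𝕜 := ℂ) (a - b')).symm.trans ?_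
    rw [inner_sub_left, inner_sub_right, inner_sub_right, hcr, hcr', inner_self_eq_norm_sq_to_K,
      inner_self_eq_norm_sq_to_K, ha, hb1]
    push_cast
    ring
  have hi : inner ℂ (a - b') a = 1 - (ρ : ℂ) := by
    simp only [inner_sub_left, hcr, inner_self_eq_norm_sq_to_K, ha]
    push_cast
    ring
  have hρ : (1 - (ρ : ℂ)) ≠ 0 := by
    intro h
    rw [h, mul_zero] at hn
    exact hv (by simpa using hn)
  have : (1 - (ρ : ℂ)) / (2 * (1 - ρ)) = 1 / 2 := by field_simp
  simp only [LinearIsometryEquiv.trans_apply, LinearIsometryEquiv.coe_neg,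
    Submodule.reflection_singleton_apply]
  erw [hn]
  rw [hi, this, ← hb', two_smul, ← add_smul]
  norm_num

/-- An isometric linear involution as a unitary. -/
def unitaryOfInvolution {E : Type*} [NormedAddCommGroup E] [InnerProductSpace ℂ E]
    (L : E →ₗ[ℂ] E) (hL : ∀ ψ, L (L ψ) = ψ) (hn : ∀ ψ, ‖L ψ‖ = ‖ψ‖) : E ≃ₗᵢ[ℂ] E where
  toLinearEquiv := LinearEquiv.ofInvolutive L hL
  norm_map' := hn

section

variable {d : ℕ} {W : Type}

theorem norm_sq_eq_tsum (ψ : State d W) : ‖ψ‖ ^ 2 = ∑' b, ‖ψ b‖ ^ 2 := by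
  have := lp.norm_rpow_eq_tsum (p := 2) (by norm_num) ψ
  simpa using this

theorem norm_eq_of_tsum_eq {ψ φ : State d W} (h : ∑' b, ‖ψ b‖ ^ 2 = ∑' b, ‖φ b‖ ^ 2) :
    ‖ψ‖ = ‖φ‖ := by
  rw [← norm_sq_eq_tsum, ← norm_sq_eq_tsum] at h
  exact (sq_eq_sq₀ (norm_nonneg _) (norm_nonneg _)).1 h

theorem permute_apply (e : Equiv.Perm (Label d W)) (ψ : State d W) (b : Label d W) :
    permute e ψ b = ψ (e.symm b) := rfl

/-- A permutation of the basis as a unitary. -/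
def permuteUnitary (e : Equiv.Perm (Label d W)) : State d W ≃ₗᵢ[ℂ] State d W where
  toFun := permute e
  invFun := permute e.symm
  left_inv ψ := lp.ext (funext fun b => by simp [permute_apply])
  right_inv ψ := lp.ext (funext fun b => by simp [permute_apply])
  map_add' ψ φ := rfl
  map_smul' c ψ := rfl
  norm_map' ψ := norm_eq_of_tsum_eq (e.symm.tsum_eq fun b => ‖ψ b‖ ^ 2)

theorem permuteUnitary_apply (e : Equiv.Perm (Label d W)) (ψ : State d W) (b : Label d W) :
    permuteUnitary e ψ b = ψ (e.symm b) := rfl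

theorem permuteUnitary_symm (e : Equiv.Perm (Label d W)) :
    (permuteUnitary e).symm = permuteUnitary e.symm := rfl

open Classical in
/-- The unitary that flips the sign of the basis states with the property `p`. -/
def signFlip (p : Label d W → Prop) : State d W ≃ₗᵢ[ℂ] State d W :=
  unitaryOfInvolution
    { toFun := fun ψ => ⟨fun b => if p b then -ψ b else ψ b,
        Memℓp.mono' (lp.memℓp ψ) fun b => by split_ifs <;> simp⟩
      map_add' := fun ψ φ => lp.ext (funext fun b => by
        change (if p b then -(ψ b + φ b) else ψ b + φ b)
          = (if p b then -ψ b else ψ b) + (if p b then -φ b else φ b)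
        split_ifs <;> ring)
      map_smul' := fun c ψ => lp.ext (funext fun b => by
        change (if p b then -(c * ψ b) else c * ψ b) = c * (if p b then -ψ b else ψ b)
        split_ifs <;> ring) }
    (fun ψ => lp.ext (funext fun b => by
      change (if p b then -(if p b then -ψ b else ψ b) else (if p b then -ψ b else ψ b)) = ψ b
      split_ifs <;> simp))
    (fun ψ => norm_eq_of_tsum_eq (tsum_congr fun b => by
      change ‖if p b then -ψ b else ψ b‖ ^ 2 = _
      split_ifs <;> simp))

open Classical in
theorem signFlip_apply (p : Label d W → Prop) (ψ : State d W) (b : Label d W) :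
    signFlip p ψ b = if p b then -ψ b else ψ b := rfl

/-- The cyclic shift of the index register. -/
def shiftPerm [NeZero d] (i : Fin d) : Equiv.Perm (Label d W) :=
  (Equiv.addRight i).prodCongr (Equiv.refl _)

/-- The linear map `2 A - 1`, where `A` averages over the index register. -/
def diffusionMap (d : ℕ) [NeZero d] (W : Type) : State d W →ₗ[ℂ] State d W :=
  (2 / d : ℂ) • ∑ i, (permuteUnitary (shiftPerm (W := W) i)).toLinearEquiv.toLinearMap
    - LinearMap.id

theorem diffusionMap_apply [NeZero d] (ψ : State d W) (j : Fin d) (z : ℝ) (ω : W) :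
    diffusionMap d W ψ (j, z, ω) = 2 / d * ∑ i, ψ (i, z, ω) - ψ (j, z, ω) := by
  have h : diffusionMap d W ψ
      = (2 / d : ℂ) • ∑ i, permuteUnitary (shiftPerm (W := W) i) ψ - ψ := by
    simp [diffusionMap]
  rw [h, lp.coeFn_sub, lp.coeFn_smul, lp.coeFn_sum, Pi.sub_apply, Pi.smul_apply, Finset.sum_apply,
    smul_eq_mul, ← Equiv.sum_comp (Equiv.subLeft j)]
  refine congrArg (fun s => 2 / (d : ℂ) * s - ψ (j, z, ω)) (Finset.sum_congr rfl fun i _ => ?_)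
  rw [permuteUnitary_apply]
  refine congrArg (fun k => ψ (k, z, ω)) ?_
  change j + -(j - i) = i
  abel

theorem diffusionMap_diffusionMap [NeZero d] (ψ : State d W) :
    diffusionMap d W (diffusionMap d W ψ) = ψ := by
  refine lp.ext (funext fun ⟨j, z, ω⟩ => ?_)
  have hd : (d : ℂ) ≠ 0 := by exact_mod_cast NeZero.ne d
  simp only [diffusionMap_apply, Finset.sum_sub_distrib, Finset.sum_const, Finset.card_univ,
    Fintype.card_fin, nsmul_eq_mul]
  field_simp
  ring

/-- The adjoint of the shift by `i` is the shift by `-i`, so the sum over all shifts is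
self-adjoint. A self-adjoint involution preserves norms. -/
theorem inner_diffusionMap [NeZero d] (ψ φ : State d W) :
    inner ℂ (diffusionMap d W ψ) φ = inner ℂ ψ (diffusionMap d W φ) := by
  have h : ∀ ψ : State d W, diffusionMap d W ψ
      = (2 / d : ℂ) • ∑ i, permuteUnitary (shiftPerm (W := W) i) ψ - ψ := by
    simp [diffusionMap]
  have hs : ∀ i : Fin d, (permuteUnitary (shiftPerm (W := W) i)).symm
      = permuteUnitary (shiftPerm (-i)) := by
    intro i
    rw [permuteUnitary_symm]
    congr 1
    ext b : 1
    simp [shiftPerm, Equiv.addRight]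
  have hc : (starRingEnd ℂ) (2 / d : ℂ) = 2 / d := by
    rw [map_div₀, map_ofNat, map_natCast]
  rw [h, h, inner_sub_left, inner_sub_right, inner_smul_left, inner_smul_right, sum_inner,
    inner_sum, hc, ← Equiv.sum_comp (Equiv.neg (Fin d))]
  congr 2
  refine Finset.sum_congr rfl fun i _ => ?_
  rw [Equiv.neg_apply, ← hs, LinearIsometryEquiv.inner_map_eq_flip, LinearIsometryEquiv.symm_symm]

/-- Grover's diffusion operator on the index register. -/
def diffusion (d : ℕ) [NeZero d] (W : Type) : State d W ≃ₗᵢ[ℂ] State d W :=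
  unitaryOfInvolution (diffusionMap d W) diffusionMap_diffusionMap fun ψ => by
    have h : ‖diffusionMap d W ψ‖ ^ 2 = ‖ψ‖ ^ 2 := by
      have := inner_diffusionMap ψ (diffusionMap d W ψ)
      rw [diffusionMap_diffusionMap, inner_self_eq_norm_sq_to_K, inner_self_eq_norm_sq_to_K] at this
      exact_mod_cast this
    exact (sq_eq_sq₀ (norm_nonneg _) (norm_nonneg _)).1 h

theorem diffusion_apply [NeZero d] (ψ : State d W) (j : Fin d) (z : ℝ) (ω : W) :
    diffusion d W ψ (j, z, ω) = 2 / d * ∑ i, ψ (i, z, ω) - ψ (j, z, ω) :=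
  diffusionMap_apply ψ j z ω

/-! ### Finite superpositions -/

open Classical in
/-- The state with amplitude `f i` at the basis state `e i`. -/
def superpose {ι : Type} [Fintype ι] (e : ι ↪ Label d W) (f : ι → ℂ) : State d W :=
  ∑ i, lp.single 2 (e i) (f i)

open Classical in
theorem superpose_apply {ι : Type} [Fintype ι] (e : ι ↪ Label d W) (f : ι → ℂ) (b : Label d W) :
    superpose e f b = ∑ i, if b = e i then f i else 0 := by
  simp only [superpose, lp.coeFn_sum, Finset.sum_apply, lp.single_apply, Pi.single_apply]

theorem superpose_apply_self {ι : Type} [Fintype ι] (e : ι ↪ Label d W) (f : ι → ℂ) (i : ι) :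
    superpose e f (e i) = f i := by
  classical
  simp [superpose_apply]

theorem superpose_apply_of_notMem {ι : Type} [Fintype ι] (e : ι ↪ Label d W) (f : ι → ℂ)
    {b : Label d W} (hb : b ∉ Set.range e) : superpose e f b = 0 := by
  classical
  rw [superpose_apply]
  exact Finset.sum_eq_zero fun i _ => if_neg fun h => hb ⟨i, h.symm⟩

theorem norm_sq_superpose {ι : Type} [Fintype ι] (e : ι ↪ Label d W) (f : ι → ℂ) :
    ‖superpose e f‖ ^ 2 = ∑ i, ‖f i‖ ^ 2 := by
  rw [norm_sq_eq_tsum, ← e.injective.tsum_eq, tsum_fintype]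
  · simp only [superpose_apply_self]
  · intro b hb
    by_contra h
    simp [superpose_apply_of_notMem e f h] at hb

theorem norm_superpose {ι : Type} [Fintype ι] (e : ι ↪ Label d W) {f : ι → ℂ}
    (hf : ∑ i, ‖f i‖ ^ 2 = 1) : ‖superpose e f‖ = 1 := by
  rw [← norm_sq_superpose e f] at hf
  exact (pow_eq_one_iff_of_nonneg (norm_nonneg _) two_ne_zero).1 hf

end

/-! ### Scalars and locality of circuits -/

section

variable {d n : ℕ} {W : Type}

theorem Gate.apply_smul (x : ℕ → EuclideanSpace ℝ (Fin d)) (G : Gate d W n) (c : ℂ)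
    (ψ : State d W) : G.apply x (c • ψ) = c • G.apply x ψ := by
  cases G with
  | unitary U => exact U.map_smul c ψ
  | query s => rfl
  | queryInv s => rfl

/-- Branches are only tracked up to a scalar, which collects phases and measurement amplitudes. -/
theorem Circuit.apply_smul (x : ℕ → EuclideanSpace ℝ (Fin d)) (G : Circuit d W n) (c : ℂ)
    (ψ : State d W) : G.apply x (c • ψ) = c • G.apply x ψ := by
  unfold Circuit.apply
  induction G generalizing ψ with
  | nil => rfl
  | cons A G ih => rw [List.foldl_cons, List.foldl_cons, Gate.apply_smul, ih]

theorem Circuit.apply_append (x : ℕ → EuclideanSpace ℝ (Fin d)) (G H : Circuit d W n)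
    (ψ : State d W) : Circuit.apply x (G ++ H) ψ = Circuit.apply x H (Circuit.apply x G ψ) :=
  List.foldl_append

theorem Circuit.apply_congr {x x' : ℕ → EuclideanSpace ℝ (Fin d)} (h : ∀ s < n, x s = x' s)
    (G : Circuit d W n) (ψ : State d W) : G.apply x ψ = G.apply x' ψ := by
  unfold Circuit.apply
  induction G generalizing ψ with
  | nil => rfl
  | cons A G ih =>
    rw [List.foldl_cons, List.foldl_cons, ih]
    congr 1
    cases A with
    | unitary U => rfl
    | query s => simp only [Gate.apply, h s s.2]
    | queryInv s => simp only [Gate.apply, h s s.2]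

theorem Circuit.cost_append (G H : Circuit d W n) :
    Circuit.cost (G ++ H) = Circuit.cost G + Circuit.cost H := by
  simp [Circuit.cost]

end

/-! ### Grover's iteration on amplitude vectors -/

section Amplitudes

variable {d : ℕ}

open Classical in
/-- One Grover iteration: flip the signs of the marked amplitudes, then reflect at the mean. -/
def groverStep (m : Fin d → Prop) (f : Fin d → ℝ) : Fin d → ℝ :=
  fun j => 2 / d * ∑ i, (if m i then -f i else f i) - (if m j then -f j else f j)

/-- The amplitudes after `n` Grover iterations on the uniform superposition. -/
def groverAmp (m : Fin d → Prop) : ℕ → Fin d → ℝ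
  | 0 => fun _ => 1 / Real.sqrt d
  | n + 1 => groverStep m (groverAmp m n)

theorem sum_sq_groverStep [NeZero d] (m : Fin d → Prop) (f : Fin d → ℝ) :
    ∑ j, groverStep m f j ^ 2 = ∑ j, f j ^ 2 := by
  classical
  have hd : (d : ℝ) ≠ 0 := by exact_mod_cast NeZero.ne d
  have h : ∑ j, f j ^ 2 = ∑ j, (if m j then -f j else f j) ^ 2 :=
    Finset.sum_congr rfl fun j _ => by split_ifs <;> ring
  have key : ∀ F : Fin d → ℝ, ∑ j, (2 / d * ∑ i, F i - F j) ^ 2 = ∑ j, F j ^ 2 := by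
    intro F
    simp only [sub_sq, Finset.sum_add_distrib, Finset.sum_sub_distrib, Finset.sum_const,
      Finset.card_univ, Fintype.card_fin, nsmul_eq_mul, ← Finset.mul_sum]
    field_simp
    ring
  rw [h]
  exact key _

theorem sum_sq_groverAmp [NeZero d] (m : Fin d → Prop) (n : ℕ) :
    ∑ j, groverAmp m n j ^ 2 = 1 := by
  induction n with
  | zero =>
    have hd : (d : ℝ) ≠ 0 := by exact_mod_cast NeZero.ne d
    simp [groverAmp, hd]
  | succ n ih => rw [groverAmp, sum_sq_groverStep, ih]

/-- The common (rescaled) amplitudes of the marked and of the unmarked indices after `n` Grover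
iterations, if the fraction `ρ` of the indices is marked. -/
def groverRec (ρ : ℝ) : ℕ → ℝ × ℝ
  | 0 => (1, 1)
  | n + 1 => ((groverRec ρ n).1 + 2 * (groverRec ρ n).2
        - 2 * ρ * ((groverRec ρ n).1 + (groverRec ρ n).2),
      (groverRec ρ n).2 - 2 * ρ * ((groverRec ρ n).1 + (groverRec ρ n).2))

open Classical in
-- The iteration never distinguishes two marked or two unmarked indices, so it acts on a pair of
-- amplitudes.
theorem groverAmp_eq [NeZero d] (m : Fin d → Prop) (n : ℕ) (j : Fin d) :
    groverAmp m n j = (if m j then (groverRec ((Finset.univ.filter m).card / d) n).1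
      else (groverRec ((Finset.univ.filter m).card / d) n).2) / Real.sqrt d := by
  have hd : (d : ℝ) ≠ 0 := by exact_mod_cast NeZero.ne d
  have hcard : ((Finset.univ.filter fun i => ¬ m i).card : ℝ)
      = d - (Finset.univ.filter m).card := by
    have := Finset.card_filter_add_card_filter_not (s := (Finset.univ : Finset (Fin d))) m
    rw [Finset.card_univ, Fintype.card_fin] at this
    rw [eq_sub_iff_add_eq']
    exact_mod_cast this
  induction n generalizing j with
  | zero => simp [groverAmp, groverRec]
  | succ n ih =>
    rw [groverAmp, groverStep]
    obtain ⟨A, hA⟩ : ∃ A, A = (groverRec ((Finset.univ.filter m).card / d) n).1 := ⟨_, rfl⟩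
    obtain ⟨B, hB⟩ : ∃ B, B = (groverRec ((Finset.univ.filter m).card / d) n).2 := ⟨_, rfl⟩
    have hs : ∑ i, (if m i then -groverAmp m n i else groverAmp m n i)
        = ∑ i, if m i then -A / Real.sqrt d else B / Real.sqrt d := by
      refine Finset.sum_congr rfl fun i _ => ?_
      rw [ih, hA, hB]
      split_ifs <;> ring
    rw [hs, Finset.sum_ite, Finset.sum_const, Finset.sum_const, nsmul_eq_mul, nsmul_eq_mul, hcard,
      ih, groverRec, ← hA, ← hB]
    split_ifs
    · field_simp
      ring
    · field_simp
      ring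

/-- The marked amplitude grows by the sum of the old and the new unmarked amplitude. As long as `ρ *
n ^ 2` is small, the latter stay between `1 / 2` and `1`, so the growth per iteration is between `1`
and `2`. This linear growth replaces the exact trigonometric formula. -/
theorem groverRec_bounds {ρ : ℝ} (hρ : 0 ≤ ρ) (n : ℕ) (hn : 2 * ρ * (n * (n + 1)) ≤ 1 / 2) :
    n + 1 ≤ (groverRec ρ n).1 ∧ (groverRec ρ n).1 ≤ 2 * n + 1 ∧ (groverRec ρ n).2 ≤ 1 ∧
      1 - 2 * ρ * (n * (n + 1)) ≤ (groverRec ρ n).2 := by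
  induction n with
  | zero => simp [groverRec]
  | succ n ih =>
    push_cast at hn ⊢
    have hn0 : (0 : ℝ) ≤ n := n.cast_nonneg
    obtain ⟨h1, h2, h3, h4⟩ := ih (by nlinarith)
    have hB : 1 / 2 ≤ (groverRec ρ n).2 := by nlinarith
    have e1 : 2 * ρ * ((groverRec ρ n).1 + (groverRec ρ n).2) ≤ 2 * ρ * (2 * n + 2) :=
      mul_le_mul_of_nonneg_left (by linarith) (by positivity)
    have e0 : 0 ≤ 2 * ρ * ((groverRec ρ n).1 + (groverRec ρ n).2) :=
      mul_nonneg (by positivity) (by linarith)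
    simp only [groverRec]
    refine ⟨?_, ?_, ?_, ?_⟩ <;> nlinarith

/-- With at most `r` marked indices and the right number of iterations, every marked index is
found with probability at least `1 / (8 r)`. -/
theorem le_sq_groverAmp [NeZero d] {m : Fin d → Prop} {r : ℕ} (hr : 1 ≤ r)
    (hm : {j | m j}.ncard ≤ r) {j : Fin d} (hj : m j) :
    1 / (8 * (r : ℝ)) ≤ groverAmp m (Nat.sqrt (d / (8 * r))) j ^ 2 := by
  classical
  have hd : (0 : ℝ) < d := by exact_mod_cast Nat.pos_of_ne_zero (NeZero.ne d)
  have hr0 : (0 : ℝ) < r := by exact_mod_cast hr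
  set N := Nat.sqrt (d / (8 * r))
  -- `hN1` keeps `N` in the range of linear growth, and `hN2` makes `(N + 1) ^ 2 / d` at least `1 /
  -- (8 * r)`.
  have hN1 : 8 * (r : ℝ) * (N * N) ≤ d := by
    have h1 : N * N ≤ d / (8 * r) := Nat.sqrt_le _
    have h2 : 8 * r * (d / (8 * r)) ≤ d := Nat.mul_div_le _ _
    have h3 : 8 * r * (N * N) ≤ d := (Nat.mul_le_mul_left _ h1).trans h2
    exact_mod_cast h3
  have hN2 : (d : ℝ) ≤ 8 * r * ((N + 1) * (N + 1)) := by
    have h1 : d / (8 * r) < (N + 1) * (N + 1) := Nat.lt_succ_sqrt _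
    have h2 := (Nat.div_lt_iff_lt_mul (by positivity : 0 < 8 * r)).1 h1
    have h3 : d ≤ 8 * r * ((N + 1) * (N + 1)) := by rw [mul_comm]; exact h2.le
    exact_mod_cast h3
  have hcard : ((Finset.univ.filter m).card : ℝ) ≤ r := by
    rw [Set.ncard_eq_toFinset_card', Set.toFinset_ofPred] at hm
    exact_mod_cast hm
  have hNN : (N : ℝ) ≤ N * N := by
    have : N ≤ N * N := Nat.le_mul_self N
    exact_mod_cast this
  have hρ : 2 * (((Finset.univ.filter m).card : ℝ) / d) * (N * (N + 1)) ≤ 1 / 2 := by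
    rw [mul_div_assoc', div_mul_eq_mul_div, div_le_iff₀ hd]
    have : ((Finset.univ.filter m).card : ℝ) * (N * (N + 1)) ≤ r * (2 * (N * N)) :=
      mul_le_mul hcard (by linarith) (by positivity) hr0.le
    linarith
  have h := (groverRec_bounds (by positivity) N hρ).1
  rw [groverAmp_eq, if_pos hj, div_pow, Real.sq_sqrt hd.le, div_le_div_iff₀ (by positivity) hd]
  have h2 : ((N : ℝ) + 1) ^ 2 ≤ (groverRec ((Finset.univ.filter m).card / d) N).1 ^ 2 := by gcongr
  nlinarith

/-- A lower bound for the probability that `k` independent samples cover `s`. -/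
theorem one_sub_le_sum_prod {F : Fin d → ℝ} (h0 : ∀ j, 0 ≤ F j) (h1 : ∑ j, F j = 1)
    (s : Finset (Fin d)) {q : ℝ} (hq : ∀ j ∈ s, q ≤ F j) (k : ℕ) [DecidablePred
      fun a : Fin k → Fin d => ∀ j ∈ s, ∃ i, a i = j] :
    1 - s.card * (1 - q) ^ k
      ≤ ∑ a : Fin k → Fin d, if ∀ j ∈ s, ∃ i, a i = j then ∏ i, F (a i) else 0 := by
  classical
  have htot : ∑ a : Fin k → Fin d, ∏ i, F (a i) = 1 := by
    rw [← Fintype.sum_pow, h1, one_pow]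
  have hmiss : ∀ j ∈ s, ∑ a : Fin k → Fin d, (if ∃ i, a i = j then 0 else ∏ i, F (a i))
      ≤ (1 - q) ^ k := by
    intro j hj
    have : ∀ a : Fin k → Fin d, (if ∃ i, a i = j then 0 else ∏ i, F (a i))
        = ∏ i, if a i = j then 0 else F (a i) := by
      intro a
      split_ifs with h
      · obtain ⟨i, hi⟩ := h
        symm
        apply Finset.prod_eq_zero (Finset.mem_univ i)
        rw [if_pos hi]
      · exact Finset.prod_congr rfl fun i _ => (if_neg fun hi => h ⟨i, hi⟩).symm
    rw [Finset.sum_congr rfl fun a _ => this a,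
      ← Fintype.sum_pow (fun b => if b = j then 0 else F b) k]
    have hsum : ∑ b, (if b = j then 0 else F b) = 1 - F j := by
      rw [← h1, ← Finset.sum_erase_eq_sub (Finset.mem_univ j),
        ← Finset.add_sum_erase _ _ (Finset.mem_univ j), if_pos rfl, zero_add]
      exact Finset.sum_congr rfl fun b hb => if_neg (Finset.ne_of_mem_erase hb)
    rw [hsum]
    have : F j ≤ 1 := h1 ▸ Finset.single_le_sum (fun i _ => h0 i) (Finset.mem_univ j)
    have := hq j hj
    gcongr
  -- Union bound, pointwise: every tuple covers `s` or misses some element of it.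
  have hcover : ∀ a : Fin k → Fin d, ∏ i, F (a i)
      ≤ (if ∀ j ∈ s, ∃ i, a i = j then ∏ i, F (a i) else 0)
        + ∑ j ∈ s, if ∃ i, a i = j then 0 else ∏ i, F (a i) := by
    intro a
    have hp : 0 ≤ ∏ i, F (a i) := Finset.prod_nonneg fun i _ => h0 _
    have hnn : ∀ j ∈ s, 0 ≤ if ∃ i, a i = j then 0 else ∏ i, F (a i) := fun j _ => by
      split_ifs <;> simp [hp]
    split_ifs with h
    · exact le_add_of_nonneg_right (Finset.sum_nonneg hnn)
    · push Not at h
      obtain ⟨j, hj, hj'⟩ := h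
      rw [zero_add]
      refine le_trans ?_ (Finset.single_le_sum hnn hj)
      rw [if_neg]
      exact fun ⟨i, hi⟩ => hj' i hi
  have h := Finset.sum_le_sum fun a (_ : a ∈ (Finset.univ : Finset (Fin k → Fin d))) => hcover a
  rw [htot, Finset.sum_add_distrib, Finset.sum_comm] at h
  have h2 := Finset.sum_le_sum hmiss
  rw [Finset.sum_const, nsmul_eq_mul] at h2
  linarith

end Amplitudes

/-! ### Product states -/

/-- The workspace of `k` slots, each of which holds an index and a value. -/
abbrev Slots (d k : ℕ) : Type := Fin k → Fin d × ℝ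

section Product

variable {d k : ℕ}

/-- The state is the product of the state `P` of the index and value registers with the
states `F l` of the slots. -/
def IsProduct (ψ : State d (Slots d k)) (P : Fin d → ℝ → ℂ) (F : Fin k → Fin d → ℝ → ℂ) : Prop :=
  ∀ j z a, ψ (j, z, a) = P j z * ∏ l, F l (a l).1 (a l).2

open Classical in
/-- The amplitudes of `∑ j, f j |j⟩|v j⟩`. -/
def ampAt (v f : Fin d → ℝ) (j : Fin d) (z : ℝ) : ℂ := if z = v j then (f j : ℂ) else 0

theorem IsProduct.query {ψ : State d (Slots d k)} {f : Fin d → ℝ}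
    {F : Fin k → Fin d → ℝ → ℂ} (h : IsProduct ψ (ampAt (fun _ => 0) f) F)
    (x : EuclideanSpace ℝ (Fin d)) : IsProduct (permute (queryPerm _ x) ψ) (ampAt x f) F := by
  intro j z a
  refine (h j (z - x j) a).trans ?_
  simp only [ampAt, sub_eq_zero]

/-- The amplitudes sit on the graph of a function of the index; a query only changes that function.
-/
theorem IsProduct.queryInv {ψ : State d (Slots d k)} {f : Fin d → ℝ}
    {F : Fin k → Fin d → ℝ → ℂ} {x : EuclideanSpace ℝ (Fin d)} (h : IsProduct ψ (ampAt x f) F) :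
    IsProduct (permute (queryPerm _ x).symm ψ) (ampAt (fun _ => 0) f) F := by
  intro j z a
  refine (h j (z + x j) a).trans ?_
  simp only [ampAt, add_eq_right]

open Classical in
theorem IsProduct.signFlip {ψ : State d (Slots d k)} {v f : Fin d → ℝ}
    {F : Fin k → Fin d → ℝ → ℂ} (h : IsProduct ψ (ampAt v f) F) (p : Fin d → ℝ → Prop) :
    IsProduct (signFlip (fun b => p b.1 b.2.1) ψ)
      (ampAt v fun j => if p j (v j) then -f j else f j) F := by
  intro j z a
  rw [signFlip_apply, h j z a]
  by_cases hz : z = v j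
  · subst hz
    by_cases hp : p j (v j) <;> simp [ampAt, hp]
  · simp [ampAt, hz]

/-- The diffusion averages at fixed `z`, so the values must have been uncomputed for the amplitudes
to interfere. -/
theorem IsProduct.diffusion [NeZero d] {ψ : State d (Slots d k)} {f : Fin d → ℝ}
    {F : Fin k → Fin d → ℝ → ℂ} (h : IsProduct ψ (ampAt (fun _ => 0) f) F) :
    IsProduct (diffusion d _ ψ) (ampAt (fun _ => 0) fun j => 2 / d * ∑ i, f i - f j) F := by
  intro j z a
  rw [diffusion_apply]
  simp only [h _ z a, ← Finset.sum_mul, ampAt]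
  split_ifs
  · push_cast
    ring
  · simp

/-- Exchange the index and value registers with slot `i`. -/
def swapPerm (i : Fin k) : Equiv.Perm (Label d (Slots d k)) :=
  Function.Involutive.toPerm
    (fun b => ((b.2.2 i).1, (b.2.2 i).2, Function.update b.2.2 i (b.1, b.2.1)))
    fun b => by simp

/-- This recycles registers: the untouched uniform superposition of a slot becomes the starting
state of the next search, so no reset is needed. -/
theorem IsProduct.swap {ψ : State d (Slots d k)} {P : Fin d → ℝ → ℂ}
    {F : Fin k → Fin d → ℝ → ℂ} (h : IsProduct ψ P F) (i : Fin k) :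
    IsProduct (permuteUnitary (swapPerm i) ψ) (F i) (Function.update F i P) := by
  intro j z a
  refine (h _ _ _).trans ?_
  rw [Fintype.prod_eq_mul_prod_compl i, Fintype.prod_eq_mul_prod_compl i]
  have : ∀ l ∈ ({i}ᶜ : Finset (Fin k)),
      F l (Function.update a i (j, z) l).1 (Function.update a i (j, z) l).2
        = Function.update F i P l (a l).1 (a l).2 := by
    intro l hl
    have hl' : l ≠ i := by simpa using hl
    rw [Function.update_of_ne hl', Function.update_of_ne hl']
  rw [Finset.prod_congr rfl this]
  simp only [Function.update_self]
  ring

end Product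

/-! ### The search circuit -/

section Search

variable {d k : ℕ} [NeZero d]

/-- A Grover iteration for the indices `j` with `p j (x j)`, where `x` is the latest example. -/
def groverIteration (t k : ℕ) (p : Fin d → ℝ → Prop) : Circuit d (Slots d k) (t + 1) :=
  [.query (Fin.last t), .unitary (signFlip fun b => p b.1 b.2.1), .queryInv (Fin.last t),
    .unitary (diffusion d _)]

/-- `n` Grover iterations. -/
def groverPower (t k : ℕ) (p : Fin d → ℝ → Prop) : ℕ → Circuit d (Slots d k) (t + 1)
  | 0 => []
  | n + 1 => groverPower t k p n ++ groverIteration t k p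

/-- `n` Grover iterations, after which the index and its value are moved to slot `i`. -/
def slotSearch (t n : ℕ) (p : Fin d → ℝ → Prop) (i : Fin k) : Circuit d (Slots d k) (t + 1) :=
  groverPower t k p n ++ [.query (Fin.last t), .unitary (permuteUnitary (swapPerm i))]

/-- The successive searches of all slots in a list. -/
def search (t n : ℕ) (p : Fin d → ℝ → Prop) : List (Fin k) → Circuit d (Slots d k) (t + 1)
  | [] => []
  | i :: l => slotSearch t n p i ++ search t n p l

theorem cost_groverPower (t n : ℕ) (p : Fin d → ℝ → Prop) :
    Circuit.cost (groverPower t k p n) = 2 * n := by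
  induction n with
  | zero => rfl
  | succ n ih =>
    rw [groverPower, Circuit.cost_append, ih]
    rfl

theorem cost_search (t n : ℕ) (p : Fin d → ℝ → Prop) (l : List (Fin k)) :
    Circuit.cost (search t n p l) = l.length * (2 * n + 1) := by
  induction l with
  | nil => simp [search, Circuit.cost]
  | cons i l ih =>
    rw [search, slotSearch, Circuit.cost_append, Circuit.cost_append, ih, cost_groverPower,
      List.length_cons]
    change 2 * n + 1 + _ = _
    ring

theorem IsProduct.groverPower {ψ : State d (Slots d k)} {F : Fin k → Fin d → ℝ → ℂ}
    (h : IsProduct ψ (ampAt (fun _ => 0) fun _ => 1 / Real.sqrt d) F)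
    (x : ℕ → EuclideanSpace ℝ (Fin d)) (t n : ℕ) (p : Fin d → ℝ → Prop) :
    IsProduct (Circuit.apply x (groverPower t k p n) ψ)
      (ampAt (fun _ => 0) (groverAmp (fun j => p j (x t j)) n)) F := by
  induction n with
  | zero => exact h
  | succ n ih =>
    rw [SparseOnline.groverPower, Circuit.apply_append]
    exact (((ih.query (x t)).signFlip p).queryInv).diffusion

theorem IsProduct.search {ψ : State d (Slots d k)} {F : Fin k → Fin d → ℝ → ℂ}
    {l : List (Fin k)} (hl : l.Nodup)
    (h : IsProduct ψ (ampAt (fun _ => 0) fun _ => 1 / Real.sqrt d) F)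
    (hF : ∀ i ∈ l, F i = ampAt (fun _ => 0) fun _ => 1 / Real.sqrt d)
    (x : ℕ → EuclideanSpace ℝ (Fin d)) (t n : ℕ) (p : Fin d → ℝ → Prop) :
    IsProduct (Circuit.apply x (search t n p l) ψ) (ampAt (fun _ => 0) fun _ => 1 / Real.sqrt d)
      fun i => if i ∈ l then ampAt (x t) (groverAmp (fun j => p j (x t j)) n) else F i := by
  induction l generalizing ψ F with
  | nil =>
    simp only [List.not_mem_nil, if_false]
    exact h
  | cons i l ih =>
    rw [SparseOnline.search, Circuit.apply_append, slotSearch, Circuit.apply_append]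
    have h1 := ((h.groverPower x t n p).query (x t)).swap i
    rw [hF i List.mem_cons_self] at h1
    have hi : i ∉ l := (List.nodup_cons.1 hl).1
    have h2 := ih (List.nodup_cons.1 hl).2 h1 fun i' hi' => by
      rw [Function.update_of_ne (ne_of_mem_of_not_mem hi' hi)]
      exact hF i' (List.mem_cons_of_mem _ hi')
    refine Eq.mp (congrArg (IsProduct _ _) (funext fun i' => ?_)) h2
    by_cases h' : i' = i
    · subst h'
      simp [hi]
    · simp [h']

end Search

/-! ### Success probabilities round by round -/

section Causality

variable {d : ℕ} {W M : Type} (E : Adversary d) {τ τ' : Transcript M} {t : ℕ}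

theorem reports_congr (h : ∀ i < t, τ i = τ' i) : τ.reports t = τ'.reports t :=
  funext fun i => by simp [Transcript.reports, Transcript.pred, Transcript.est, h i i.2]

theorem Adversary.x_congr (h : ∀ i < t, τ i = τ' i) : E.x τ t = E.x τ' t := by
  rw [Adversary.x, Adversary.x, reports_congr h]

theorem Adversary.y_congr (h : ∀ i ≤ t, τ i = τ' i) : E.y τ t = E.y τ' t := by
  rw [Adversary.y, Adversary.y, reports_congr fun i hi => h i (le_of_lt hi), Transcript.pred,
    Transcript.pred, h t le_rfl]

theorem records_congr (h : ∀ i < t, τ i = τ' i) : records E τ t = records E τ' t :=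
  funext fun i => by
    simp only [records, h i i.2, E.y_congr fun s hs => h s (lt_of_le_of_lt hs i.2)]

/-- Even against an adaptive adversary, the outcome of round `t` can be altered without affecting
the state before it, so probabilities can be computed round by round. -/
theorem Learner.branch_congr (A : Learner d W M) (h : ∀ i < t, τ i = τ' i) :
    A.branch E τ t = A.branch E τ' t := by
  induction t with
  | zero => rfl
  | succ t ih =>
    have h' : ∀ i < t, τ i = τ' i := fun i hi => h i (by omega)
    have hx : ∀ s < t + 1, E.x τ s = E.x τ' s := fun s hs =>
      E.x_congr fun i hi => h i (by omega)
    have hy : E.y τ t = E.y τ' t := E.y_congr fun s hs => h s (by omega)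
    simp only [Learner.branch, records_congr E h', ih h', h t (by omega), hy,
      Circuit.apply_congr hx]

end Causality

theorem extend_snoc {M : Type} [Inhabited M] {n : ℕ} (σ : Fin n → Outcome M × Outcome M)
    (o : Outcome M × Outcome M) :
    extend (Fin.snoc (α := fun _ => Outcome M × Outcome M) σ o)
      = Function.update (extend σ) n o := by
  funext t
  rcases lt_trichotomy t n with h | h | h
  · rw [Function.update_of_ne h.ne]
    simp [extend, h, Nat.lt_succ_of_lt h, Fin.snoc]
  · subst h
    simp [extend, Fin.snoc]
  · rw [Function.update_of_ne h.ne']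
    simp [extend, not_lt.2 h.le, not_lt.2 (Nat.succ_le_of_lt h)]

open Classical in
theorem Learner.prob_eq_tsum {d : ℕ} {W M : Type} [Inhabited M] (A : Learner d W M)
    (E : Adversary d) (T : ℕ) (P : Transcript M → Prop) :
    A.prob E T P = ∑' σ : Fin T → Outcome M × Outcome M,
      if P (extend σ) then ‖A.branch E (extend σ) T‖ₑ ^ 2 else 0 :=
  (tsum_subtype {σ : Fin T → Outcome M × Outcome M | P (extend σ)}
    fun σ => ‖A.branch E (extend σ) T‖ₑ ^ 2)

theorem Learner.prob_mono {d : ℕ} {W M : Type} [Inhabited M] (A : Learner d W M)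
    (E : Adversary d) (T : ℕ) {P Q : Transcript M → Prop} (h : ∀ τ, P τ → Q τ) :
    A.prob E T P ≤ A.prob E T Q := by
  classical
  rw [A.prob_eq_tsum, A.prob_eq_tsum]
  refine ENNReal.tsum_le_tsum fun σ => ?_
  by_cases hP : P (extend σ)
  · rw [if_pos hP, if_pos (h _ hP)]
  · simp [hP]

open Classical in
/-- If every round goes well with conditional probability at least `p`, then `n` rounds go well
with probability at least `p ^ n`. -/
theorem Learner.pow_le_prob {d : ℕ} {W M : Type} [Inhabited M] (A : Learner d W M)
    (E : Adversary d) (T : ℕ) (Good : ℕ → Transcript M → Prop)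
    (hcongr : ∀ t τ τ', (∀ i ≤ t, τ i = τ' i) → (Good t τ ↔ Good t τ')) (p : ℝ≥0∞)
    (hstep : ∀ t < T, ∀ τ : Transcript M, (∀ s < t, Good s τ) →
      p * ‖A.branch E τ t‖ₑ ^ 2 ≤ ∑' o : Outcome M × Outcome M,
        if Good t (Function.update τ t o) then ‖A.branch E (Function.update τ t o) (t + 1)‖ₑ ^ 2
        else 0) {n : ℕ} (hn : n ≤ T) :
    p ^ n ≤ A.prob E n fun τ => ∀ s < n, Good s τ := by
  induction n with
  | zero =>
    rw [A.prob_eq_tsum, tsum_eq_single default fun σ hσ => absurd (Subsingleton.elim _ _) hσ]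
    have h : ‖A.init‖ₑ = 1 := by rw [← ofReal_norm, A.norm_init, ENNReal.ofReal_one]
    simp [Learner.branch, h]
  | succ n ih =>
    -- The transcripts are split into a prefix and a last outcome, with the sum over the last
    -- outcome inside.
    rw [A.prob_eq_tsum, ← (Fin.snocEquiv fun _ => Outcome M × Outcome M).tsum_eq,
      ENNReal.tsum_prod', ENNReal.tsum_comm, pow_succ']
    refine (mul_le_mul_right (ih (by omega)) p).trans ?_
    rw [A.prob_eq_tsum, ← ENNReal.tsum_mul_left]
    refine ENNReal.tsum_le_tsum fun σ => ?_
    by_cases hσ : ∀ s < n, Good s (extend σ)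
    · rw [if_pos hσ]
      refine (hstep n (by omega) _ hσ).trans (ENNReal.tsum_le_tsum fun o => ?_)
      rw [show (Fin.snocEquiv fun _ => Outcome M × Outcome M) (o, σ)
        = Fin.snoc (α := fun _ => Outcome M × Outcome M) σ o from rfl, extend_snoc]
      by_cases ho : Good n (Function.update (extend σ) n o)
      · rw [if_pos ho, if_pos]
        intro s hs
        rcases Nat.lt_succ_iff_lt_or_eq.1 hs with h | rfl
        · refine (hcongr s _ _ fun i hi => ?_).1 (hσ s h)
          rw [Function.update_of_ne (by omega)]
        · exact ho
      · rw [if_neg ho]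
        exact zero_le
    · rw [if_neg hσ, mul_zero]
      exact zero_le

/-! ### The states of the learner -/

section States

variable {d k : ℕ} [NeZero d]

/-- The basis states in which the value register is `0` and the slots hold indices with their
values. -/
def loadedLabel (k : ℕ) (v : Fin d → ℝ) : Fin d × (Fin k → Fin d) ↪ Label d (Slots d k) where
  toFun q := (q.1, 0, fun l => (q.2 l, v (q.2 l)))
  inj' q q' h := by
    simp only [Prod.mk.injEq, funext_iff] at h
    exact Prod.ext h.1 (funext fun l => (h.2.2 l).1)

/-- The uniform superposition of the index register and of all slots. -/
def uniformState (d k : ℕ) [NeZero d] : State d (Slots d k) :=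
  superpose (loadedLabel k fun _ => 0) fun _ => (((1 / Real.sqrt d) ^ (k + 1) : ℝ) : ℂ)

theorem norm_uniformState : ‖uniformState d k‖ = 1 := by
  have hd : (0 : ℝ) < d := by exact_mod_cast Nat.pos_of_ne_zero (NeZero.ne d)
  refine norm_superpose _ ?_
  rw [Finset.sum_const, Finset.card_univ, Fintype.card_prod, Fintype.card_fun, Fintype.card_fin,
    Fintype.card_fin, nsmul_eq_mul, Complex.norm_real, Real.norm_of_nonneg (by positivity),
    ← pow_mul, mul_comm (k + 1), pow_mul, div_pow, Real.sq_sqrt hd.le, div_pow, ← pow_succ']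
  push_cast
  rw [mul_div_assoc', one_pow, one_pow, mul_one, div_self (by positivity)]

theorem isProduct_uniformState :
    IsProduct (uniformState d k) (ampAt (fun _ => 0) fun _ => 1 / Real.sqrt d)
      fun _ => ampAt (fun _ => 0) fun _ => 1 / Real.sqrt d := by
  intro j z a
  by_cases h : z = 0 ∧ ∀ l, (a l).2 = 0
  · have hb : (j, z, a) = loadedLabel k (fun _ => 0) (j, fun l => (a l).1) := by
      refine Prod.ext rfl (Prod.ext h.1 (funext fun l => Prod.ext rfl (h.2 l)))
    rw [uniformState, hb, superpose_apply_self]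
    simp [ampAt, h.1, h.2, pow_succ']
  · rw [uniformState, superpose_apply_of_notMem]
    · rw [not_and_or, not_forall] at h
      rcases h with h | ⟨l, hl⟩
      · simp [ampAt, h]
      · rw [Finset.prod_eq_zero (Finset.mem_univ l), mul_zero]
        simp [ampAt, hl]
    · rintro ⟨q, hq⟩
      refine h ⟨?_, fun l => ?_⟩
      · exact (congrArg (fun b : Label d (Slots d k) => b.2.1) hq).symm
      · exact (congrArg (fun b : Label d (Slots d k) => (b.2.2 l).2) hq).symm

/-- The basis states with cleared value register and slots. -/
def clearedLabel (d k : ℕ) [NeZero d] : Fin d ↪ Label d (Slots d k) where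
  toFun j := (j, 0, fun _ => (0, 0))
  inj' _ _ h := congrArg Prod.fst h

/-- The state `|w⟩` in the index register. -/
def weightState (k : ℕ) (w : EuclideanSpace ℝ (Fin d)) : State d (Slots d k) :=
  superpose (clearedLabel d k) fun j => ((Real.sqrt (|w j| / ∑ i, |w i|) : ℝ) : ℂ)

theorem norm_weightState {w : EuclideanSpace ℝ (Fin d)} (hw : w ≠ 0) :
    ‖weightState k w‖ = 1 := by
  have hs : 0 < ∑ i, |w i| := by
    obtain ⟨j, hj⟩ : ∃ j, w j ≠ 0 := by
      by_contra! h
      exact hw (PiLp.ext h)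
    exact Finset.sum_pos' (fun i _ => abs_nonneg _) ⟨j, Finset.mem_univ j, abs_pos.2 hj⟩
  refine norm_superpose _ ?_
  have : ∀ j, ‖((Real.sqrt (|w j| / ∑ i, |w i|) : ℝ) : ℂ)‖ ^ 2 = |w j| / ∑ i, |w i| := by
    intro j
    rw [Complex.norm_real, Real.norm_of_nonneg (Real.sqrt_nonneg _), Real.sq_sqrt (by positivity)]
  rw [Finset.sum_congr rfl fun j _ => this j, ← Finset.sum_div, div_self hs.ne']

theorem prepared_smul_weightState (a : ℂ) (w : EuclideanSpace ℝ (Fin d)) :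
    Prepared (a • weightState k w) w := by
  classical
  refine ⟨fun z ω => a * if z = 0 ∧ ω = fun _ => (0, 0) then 1 else 0, fun j z ω => ?_⟩
  change a * weightState k w (j, z, ω) = _ * (a * if z = 0 ∧ ω = fun _ => (0, 0) then 1 else 0)
  by_cases h : z = 0 ∧ ω = fun _ => (0, 0)
  · have hb : (j, z, ω) = clearedLabel d k j := by rw [h.1, h.2]; rfl
    rw [if_pos h, weightState, hb, superpose_apply_self]
    ring
  · rw [if_neg h, weightState, superpose_apply_of_notMem]
    · ring
    · rintro ⟨q, hq⟩
      exact h ⟨(congrArg (fun b : Label d (Slots d k) => b.2.1) hq).symm,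
        (congrArg (fun b : Label d (Slots d k) => b.2.2) hq).symm⟩

open Classical in
/-- The state kept between the rounds if `w` is the current weight vector. -/
def restState (k : ℕ) (w : EuclideanSpace ℝ (Fin d)) : State d (Slots d k) :=
  if w = 0 then uniformState d k else weightState k w

theorem norm_restState (w : EuclideanSpace ℝ (Fin d)) : ‖restState k w‖ = 1 := by
  unfold restState
  split_ifs with h
  · exact norm_uniformState
  · exact norm_weightState h

end States

section Transport

variable {d : ℕ} {W : Type}

open Classical in
/-- A unitary that maps `ψ` to `φ`, up to a phase, if these are unit vectors. -/
def transport (ψ φ : State d W) : State d W ≃ₗᵢ[ℂ] State d W :=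
  if h : ‖ψ‖ = 1 ∧ ‖φ‖ = 1 then (exists_unitary_apply_eq_smul h.1 h.2).choose
  else LinearIsometryEquiv.refl ℂ _

theorem exists_transport_apply {ψ φ : State d W} (hψ : ‖ψ‖ = 1) (hφ : ‖φ‖ = 1) :
    ∃ c : ℂ, ‖c‖ = 1 ∧ transport ψ φ ψ = c • φ := by
  unfold transport
  rw [dif_pos ⟨hψ, hφ⟩]
  exact (exists_unitary_apply_eq_smul hψ hφ).choose_spec

open Classical in
/-- The basis state `|b⟩`. -/
def basisState (b : Label d W) : State d W := lp.single 2 b 1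

theorem norm_basisState (b : Label d W) : ‖basisState b‖ = 1 := by
  classical
  rw [basisState, lp.norm_single (by norm_num), norm_one]

/-- An injective outcome reveals the whole basis label, so only one amplitude survives. -/
theorem collapse_of_injective {O : Type} {m : Label d W → O} (hm : Function.Injective m)
    (b : Label d W) (ψ : State d W) : collapse m (m b) ψ = ψ b • basisState b := by
  classical
  refine lp.ext (funext fun b' => ?_)
  change Set.indicator {b' | m b' = m b} ψ b' = ψ b * basisState b b'
  rw [basisState, lp.single_apply, Set.indicator_apply, Pi.single_apply]
  by_cases h : b' = b
  · simp [h]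
  · simp [h, hm.ne h]

theorem collapse_const {O : Type} (o : O) (ψ : State d W) :
    collapse (fun _ => o) o ψ = ψ := by
  refine lp.ext (funext fun b => ?_)
  change Set.indicator {b | o = o} ψ b = ψ b
  simp

end Transport

/-! ### Updates from the important coordinates -/

section Sparse

variable {d k : ℕ}

theorem trunc_eq_zero {v α θ : ℝ} (hα : |v| ≤ α) (hθ : |v| ≤ θ) : trunc v α θ = 0 := by
  have h1 := abs_le.1 hα
  have h2 := abs_le.1 hθ
  unfold trunc
  split_ifs with h3 h4
  · exact max_eq_right (by linarith)
  · exact min_eq_right (by linarith)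
  · exfalso
    rcases le_total 0 v with h | h
    · exact h3 ⟨h, h2.2⟩
    · exact h4 ⟨h2.1, h⟩

/-- The displacement is at most `η * c`, which neither exceeds the gravity `g * η` nor leaves the
threshold region. This is the source of sparsity. -/
theorem hingeStep_apply_eq_zero {η θ g c : ℝ} (hη : 0 < η) (hc : 0 ≤ c) (hcg : c ≤ g)
    (hcθ : η * c ≤ θ) {w x : EuclideanSpace ℝ (Fin d)} {y : ℝ} (hy : y = 1 ∨ y = -1) (ytil : ℝ)
    {j : Fin d} (hw : w j = 0) (hx : |x j| ≤ c) : hingeStep η θ g w x y ytil j = 0 := by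
  have hv : |if y * ytil < 1 then w j + η * y * x j else w j| ≤ η * c := by
    have habs : |y| = 1 := by rcases hy with rfl | rfl <;> simp
    split_ifs
    · rw [hw, zero_add, abs_mul, abs_mul, habs, mul_one, abs_of_pos hη]
      gcongr
    · rw [hw, abs_zero]
      positivity
  refine trunc_eq_zero (hv.trans ?_) (hv.trans hcθ)
  rw [mul_comm]
  gcongr

open Classical in
/-- The example that is read off from the slots, with `0` for the missing coordinates. -/
def decode (b : Label d (Slots d k)) : EuclideanSpace ℝ (Fin d) :=
  WithLp.toLp 2 fun j => if h : ∃ i, (b.2.2 i).1 = j then (b.2.2 h.choose).2 else 0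

/-- The slots hold correct values of `x`, among them the coordinates in the support of `w` and
those that exceed `c`. -/
def Captures (c : ℝ) (w x : EuclideanSpace ℝ (Fin d)) (b : Label d (Slots d k)) : Prop :=
  (∀ i, (b.2.2 i).2 = x (b.2.2 i).1) ∧ ∀ j, (w j ≠ 0 ∨ c < |x j|) → ∃ i, (b.2.2 i).1 = j

theorem Captures.decode_eq {c : ℝ} {w x : EuclideanSpace ℝ (Fin d)} {b : Label d (Slots d k)}
    (h : Captures c w x b) (j : Fin d) :
    decode b j = x j ∨ decode b j = 0 ∧ w j = 0 ∧ |x j| ≤ c := by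
  by_cases hj : ∃ i, (b.2.2 i).1 = j
  · left
    change dite _ _ _ = _
    rw [dif_pos hj, h.1, hj.choose_spec]
  · right
    have := mt (h.2 j) hj
    push Not at this
    exact ⟨dif_neg hj, this⟩

/-- Coordinates missing from the slots have weight zero, so the prediction loses nothing. -/
theorem Captures.dot_decode {c : ℝ} {w x : EuclideanSpace ℝ (Fin d)} {b : Label d (Slots d k)}
    (h : Captures c w x b) : dot w (decode b) = dot w x := by
  refine Finset.sum_congr rfl fun j _ => ?_
  rcases h.decode_eq j with h | ⟨h1, h2, -⟩
  · rw [h]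
  · rw [h2, zero_mul, zero_mul]

theorem Captures.hingeStep_decode {η θ g c : ℝ} (hη : 0 < η) (hc : 0 ≤ c) (hcg : c ≤ g)
    (hcθ : η * c ≤ θ) {w x : EuclideanSpace ℝ (Fin d)} {b : Label d (Slots d k)}
    (h : Captures c w x b) {y : ℝ} (hy : y = 1 ∨ y = -1) (ytil : ℝ) :
    hingeStep η θ g w (decode b) y ytil = hingeStep η θ g w x y ytil := by
  ext j
  rcases h.decode_eq j with h | ⟨h1, h2, h3⟩
  · simp only [hingeStep, h]
  · rw [hingeStep_apply_eq_zero hη hc hcg hcθ hy ytil h2 h3,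
      hingeStep_apply_eq_zero hη hc hcg hcθ hy ytil h2 (by rw [h1, abs_zero]; exact hc)]

/-- Each such coordinate contributes more than `c ^ 2` to `‖x‖ ^ 2`. -/
theorem ncard_lt_abs_le {c C : ℝ} (hc : 0 < c) {x : EuclideanSpace ℝ (Fin d)} (hx : ‖x‖ ≤ C) :
    {j | c < |x j|}.ncard ≤ ⌈C ^ 2 / c ^ 2⌉₊ := by
  classical
  have h : (({j | c < |x j|}.ncard : ℕ) : ℝ) * c ^ 2 ≤ C ^ 2 := by
    rw [Set.ncard_eq_toFinset_card', Set.toFinset_ofPred]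
    calc _ = ∑ j ∈ Finset.univ.filter fun j => c < |x j|, c ^ 2 := by
            rw [Finset.sum_const, nsmul_eq_mul]
      _ ≤ ∑ j ∈ Finset.univ.filter fun j => c < |x j|, x j ^ 2 := by
            refine Finset.sum_le_sum fun j hj => ?_
            rw [← sq_abs (x j)]
            have := (Finset.mem_filter.1 hj).2
            gcongr
      _ ≤ ∑ j, x j ^ 2 :=
            Finset.sum_le_sum_of_subset_of_nonneg (Finset.filter_subset _ _)
              fun j _ _ => sq_nonneg _
      _ = ‖x‖ ^ 2 := (EuclideanSpace.real_norm_sq_eq x).symm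
      _ ≤ C ^ 2 := by gcongr
  have h2 : (({j | c < |x j|}.ncard : ℕ) : ℝ) ≤ C ^ 2 / c ^ 2 := by
    rwa [le_div_iff₀ (by positivity)]
  exact_mod_cast h2.trans (Nat.le_ceil _)

theorem ncard_support_hingeStep_le {η θ g c C : ℝ} (hη : 0 < η) (hc : 0 < c) (hcg : c ≤ g)
    (hcθ : η * c ≤ θ) (w : EuclideanSpace ℝ (Fin d)) {x : EuclideanSpace ℝ (Fin d)}
    (hx : ‖x‖ ≤ C) {y : ℝ} (hy : y = 1 ∨ y = -1) (ytil : ℝ) :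
    {j | hingeStep η θ g w x y ytil j ≠ 0}.ncard
      ≤ {j | w j ≠ 0}.ncard + ⌈C ^ 2 / c ^ 2⌉₊ := by
  have hsub : {j | hingeStep η θ g w x y ytil j ≠ 0} ⊆ {j | w j ≠ 0} ∪ {j | c < |x j|} := by
    intro j hj
    by_contra h
    simp only [Set.mem_union, Set.mem_ofPred_eq, not_or, not_not, not_lt] at h
    exact hj (hingeStep_apply_eq_zero hη hc.le hcg hcθ hy ytil h.1 h.2)
  calc _ ≤ _ := Set.ncard_le_ncard hsub (Set.toFinite _)
    _ ≤ _ := Set.ncard_union_le _ _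
    _ ≤ _ := Nat.add_le_add_left (ncard_lt_abs_le hc hx) _

end Sparse

/-! ### The learner -/

section Learner

variable {d : ℕ}

/-- The learner remembers the measured label. -/
abbrev Memory (d k : ℕ) : Type := Label d (Slots d k)

/-- The weight vector computed from the measured slots. -/
def knownWeight {k : ℕ} (η θ g : ℝ) :
    (t : ℕ) → (Fin t → Record (Memory d k)) → EuclideanSpace ℝ (Fin d)
  | 0, _ => 0
  | t + 1, past =>
    hingeStep η θ g (knownWeight η θ g t (Fin.init past)) (decode (past (Fin.last t)).1.2)
      (past (Fin.last t)).2.1 (past (Fin.last t)).1.1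

variable {k n : ℕ} {η θ g c C : ℝ} (E : Adversary d)

/-- The weight vector computed along `τ` before round `t`. -/
def trackedWeight (η θ g : ℝ) (τ : Transcript (Memory d k)) (t : ℕ) : EuclideanSpace ℝ (Fin d) :=
  knownWeight η θ g t (records E τ t)

theorem trackedWeight_succ (τ : Transcript (Memory d k)) (t : ℕ) :
    trackedWeight E η θ g τ (t + 1) = hingeStep η θ g (trackedWeight E η θ g τ t)
      (decode (τ t).1.2) (E.y τ t) (τ t).1.1 := rfl

/-- `ψ` is the state that is measured in the prediction phase, if the previous round went well. -/
def IsSearchState (n : ℕ) (c : ℝ) (w x : EuclideanSpace ℝ (Fin d)) (ψ : State d (Slots d k)) :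
    Prop :=
  IsProduct ψ (ampAt (fun _ => 0) fun _ => 1 / Real.sqrt d)
    fun _ => ampAt x (groverAmp (fun j => w j ≠ 0 ∨ c < |x j|) n)

/-- By the Born rule, the slots are independent samples from the Grover distribution; the factor `1
/ d` comes from the uniform index register. -/
theorem norm_sq_loadedLabel_of_isSearchState {w x : EuclideanSpace ℝ (Fin d)} {ψ : State d (Slots d k)}
    (h : IsSearchState n c w x ψ) (q : Fin d × (Fin k → Fin d)) :
    ‖ψ (loadedLabel k x q)‖ ^ 2
      = 1 / d * ∏ i, groverAmp (fun j => w j ≠ 0 ∨ c < |x j|) n (q.2 i) ^ 2 := by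
  have hd : (0 : ℝ) ≤ d := Nat.cast_nonneg d
  have := h q.1 0 fun l => (q.2 l, x (q.2 l))
  change ψ (loadedLabel k x q) = _ at this
  rw [this]
  simp only [ampAt, if_true, norm_mul, norm_prod, Complex.norm_real, mul_pow, Finset.prod_pow,
    Real.norm_eq_abs, sq_abs, div_pow, Real.sq_sqrt hd, one_pow]
  rw [← Finset.prod_pow]
  simp only [sq_abs, Finset.prod_pow]

variable [NeZero d]

/-- Search for the coordinates of the current example that matter, measure them, and do the rest
of the computation classically. -/
def sparseLearner (d k n : ℕ) [NeZero d] (η θ g c : ℝ) : Learner d (Slots d k) (Memory d k) where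
  init := uniformState d k
  norm_init := norm_uniformState
  predCircuit t past :=
    .unitary (transport (restState k (knownWeight η θ g t past)) (uniformState d k)) ::
      search t n (fun j v => knownWeight η θ g t past j ≠ 0 ∨ c < |v|) (List.finRange k)
  predMeas t past b := (dot (knownWeight η θ g t past) (decode b), b)
  -- The measured label is classical data by now, so this unitary may depend on it and needs no
  -- query.
  estCircuit t past o y :=
    [.unitary (transport (basisState o.2)
      (restState k (hingeStep η θ g (knownWeight η θ g t past) (decode o.2) y o.1)))]
  estMeas t past o y _ :=
    (maskedNorm θ (hingeStep η θ g (knownWeight η θ g t past) (decode o.2) y o.1)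
      (hingeStep η θ g (knownWeight η θ g t past) (decode o.2) y o.1), default)

theorem queries_sparseLearner (τ : Transcript (Memory d k)) (T : ℕ) :
    (sparseLearner d k n η θ g c).queries E τ T = T * (k * (2 * n + 1)) := by
  have h : ∀ t, Circuit.cost ((sparseLearner d k n η θ g c).predCircuit t (records E τ t))
      = k * (2 * n + 1) := by
    intro t
    change 0 + Circuit.cost (search t n _ (List.finRange k)) = _
    rw [zero_add, cost_search, List.length_finRange]
  have h' : ∀ t, Circuit.cost ((sparseLearner d k n η θ g c).estCircuit t (records E τ t)
      (τ t).1 (E.y τ t)) = 0 := fun t => rfl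
  simp only [Learner.queries, h, h', Finset.sum_const, Finset.card_range, smul_eq_mul, add_zero]

/-- In round `t`, the search finds all coordinates that matter, and the reported numbers are
computed from them. -/
def GoodRound (η θ g c : ℝ) (t : ℕ) (τ : Transcript (Memory d k)) : Prop :=
  (τ t).1.1 = dot (trackedWeight E η θ g τ t) (decode (τ t).1.2) ∧
  Captures c (trackedWeight E η θ g τ t) (E.x τ t) (τ t).1.2 ∧
  (τ t).2 = (maskedNorm θ (trackedWeight E η θ g τ (t + 1)) (trackedWeight E η θ g τ (t + 1)),
    default)

theorem goodRound_congr {t : ℕ} {τ τ' : Transcript (Memory d k)} (h : ∀ i ≤ t, τ i = τ' i) :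
    GoodRound E η θ g c t τ ↔ GoodRound E η θ g c t τ' := by
  have h' : ∀ i < t, τ i = τ' i := fun i hi => h i hi.le
  unfold GoodRound trackedWeight
  rw [h t le_rfl, records_congr E h', records_congr E fun i hi => h i (Nat.lt_succ_iff.1 hi),
    E.x_congr h']

theorem trackedWeight_eq_weight (hE : E.Admissible C) (hη : 0 < η) (hc : 0 < c) (hcg : c ≤ g)
    (hcθ : η * c ≤ θ) {τ : Transcript (Memory d k)} {t : ℕ}
    (hτ : ∀ s < t, GoodRound E η θ g c s τ) :
    trackedWeight E η θ g τ t = weight η θ (fun _ => g) (E.x τ) (E.y τ) τ.pred t ∧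
      {j | trackedWeight E η θ g τ t j ≠ 0}.ncard ≤ t * ⌈C ^ 2 / c ^ 2⌉₊ := by
  induction t with
  | zero => exact ⟨rfl, by simp [trackedWeight, knownWeight]⟩
  | succ t ih =>
    obtain ⟨h1, h2⟩ := ih fun s hs => hτ s (by omega)
    have hy : E.y τ t = 1 ∨ E.y τ t = -1 := hE.2 t _ _
    have hx : ‖E.x τ t‖ ≤ C := hE.1 t _
    rw [trackedWeight_succ, (hτ t (by omega)).2.1.hingeStep_decode hη hc.le hcg hcθ hy]
    refine ⟨by rw [h1]; rfl, ?_⟩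
    have := ncard_support_hingeStep_le hη hc hcg hcθ (trackedWeight E η θ g τ t) hx hy (τ t).1.1
    rw [add_mul, one_mul]
    omega

/-- All factors picked up in a round are phases, except for the amplitude of the measured label.
That the search succeeded is not needed here. -/
theorem branch_succ {τ : Transcript (Memory d k)} {t : ℕ} {a : ℂ}
    (ha : (sparseLearner d k n η θ g c).branch E τ t
      = a • restState k (trackedWeight E η θ g τ t))
    (h1 : (τ t).1.1 = dot (trackedWeight E η θ g τ t) (decode (τ t).1.2))
    (h2 : (τ t).2 = (maskedNorm θ (trackedWeight E η θ g τ (t + 1))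
      (trackedWeight E η θ g τ (t + 1)), default)) :
    ∃ (ψ : State d (Slots d k)) (a' : ℂ),
      IsSearchState n c (trackedWeight E η θ g τ t) (E.x τ t) ψ ∧
      ‖a'‖ = ‖a‖ * ‖ψ (τ t).1.2‖ ∧
      (sparseLearner d k n η θ g c).branch E τ (t + 1)
        = a' • restState k (trackedWeight E η θ g τ (t + 1)) := by
  set w := trackedWeight E η θ g τ t with hw
  set w' := trackedWeight E η θ g τ (t + 1) with hw'
  set S : Circuit d (Slots d k) (t + 1) :=
    search t n (fun j v => w j ≠ 0 ∨ c < |v|) (List.finRange k)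
  set b := (τ t).1.2
  obtain ⟨c₁, hc₁, e₁⟩ := exists_transport_apply (norm_restState (k := k) w)
    (norm_uniformState (d := d) (k := k))
  obtain ⟨c₂, hc₂, e₂⟩ := exists_transport_apply (norm_basisState b) (norm_restState (k := k) w')
  set ψ := Circuit.apply (E.x τ) S (uniformState d k) with hψ
  have hp : (τ t).1 = (fun b => (dot w (decode b), b)) b := Prod.ext h1 rfl
  refine ⟨ψ, a * c₁ * ψ b * c₂, ?_, by simp [hc₁, hc₂], ?_⟩
  · have := isProduct_uniformState.search (List.nodup_finRange k) (fun _ _ => rfl) (E.x τ) t n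
      (fun j v => w j ≠ 0 ∨ c < |v|)
    simp only [List.mem_finRange, if_true] at this
    exact this
  · change collapse (fun _ => (maskedNorm θ w' w', default)) (τ t).2
      (transport (basisState b) (restState k w')
        (collapse (fun b => (dot w (decode b), b)) (τ t).1
          (Circuit.apply (E.x τ) S (transport (restState k w) (uniformState d k)
            ((sparseLearner d k n η θ g c).branch E τ t))))) = _
    rw [h2, collapse_const, ha, LinearIsometryEquiv.map_smul, e₁, smul_smul, Circuit.apply_smul,
      ← hψ, hp, collapse_of_injective (fun b b' h => (Prod.ext_iff.1 h).2),
      LinearIsometryEquiv.map_smul, e₂, smul_smul]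
    rfl

theorem exists_branch_eq {τ : Transcript (Memory d k)} {t : ℕ}
    (hτ : ∀ s < t, GoodRound E η θ g c s τ) :
    ∃ a : ℂ, (sparseLearner d k n η θ g c).branch E τ t
      = a • restState k (trackedWeight E η θ g τ t) := by
  induction t with
  | zero =>
    refine ⟨1, ?_⟩
    have : trackedWeight E η θ g τ 0 = 0 := rfl
    rw [one_smul, this, restState, if_pos rfl]
    rfl
  | succ t ih =>
    obtain ⟨a, ha⟩ := ih fun s hs => hτ s (by omega)
    obtain ⟨ψ, a', -, -, h⟩ := branch_succ E ha (hτ t (by omega)).1 (hτ t (by omega)).2.2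
    exact ⟨a', h⟩

/-- A round that follows good rounds is good with high conditional probability. -/
theorem le_tsum_goodRound (hE : E.Admissible C) (hη : 0 < η) (hc : 0 < c) (hcg : c ≤ g)
    (hcθ : η * c ≤ θ) {r T : ℕ} (hr : r = ⌈C ^ 2 / c ^ 2⌉₊ * T) (hr1 : 1 ≤ r)
    (hn : n = Nat.sqrt (d / (8 * r))) {p : ℝ} (hp : p ≤ 1 - r * (1 - 1 / (8 * r)) ^ k)
    {t : ℕ} (ht : t < T) {τ : Transcript (Memory d k)}
    (hτ : ∀ s < t, GoodRound E η θ g c s τ)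
    [DecidablePred fun o => GoodRound E η θ g c t (Function.update τ t o)] :
    ENNReal.ofReal p * ‖(sparseLearner d k n η θ g c).branch E τ t‖ₑ ^ 2
      ≤ ∑' o, if GoodRound E η θ g c t (Function.update τ t o) then
        ‖(sparseLearner d k n η θ g c).branch E (Function.update τ t o) (t + 1)‖ₑ ^ 2 else 0 := by
  classical
  set A := sparseLearner d k n η θ g c
  obtain ⟨a, ha⟩ := exists_branch_eq (n := n) E hτ
  set w := trackedWeight E η θ g τ t with hw
  set x := E.x τ t with hx
  set m : Fin d → Prop := fun j => w j ≠ 0 ∨ c < |x j| with hm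
  have hna : ‖A.branch E τ t‖ = ‖a‖ := by rw [ha, norm_smul, norm_restState, mul_one]
  -- The support contributes at most `t` times the ceiling and the new example one more; `t + 1 ≤
  -- T`.
  have hcard : {j | m j}.ncard ≤ r := by
    have h1 : {j | w j ≠ 0}.ncard ≤ t * ⌈C ^ 2 / c ^ 2⌉₊ :=
      (trackedWeight_eq_weight E hE hη hc hcg hcθ hτ).2
    have h2 : {j | c < |x j|}.ncard ≤ ⌈C ^ 2 / c ^ 2⌉₊ := ncard_lt_abs_le hc (hE.1 t _)
    have h3 : {j | m j}.ncard ≤ {j | w j ≠ 0}.ncard + {j | c < |x j|}.ncard :=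
      Set.ncard_union_le {j | w j ≠ 0} {j | c < |x j|}
    have h4 : (t + 1) * ⌈C ^ 2 / c ^ 2⌉₊ ≤ T * ⌈C ^ 2 / c ^ 2⌉₊ :=
      Nat.mul_le_mul_right _ ht
    rw [hr, mul_comm]
    rw [add_mul, one_mul] at h4
    omega
  -- the outcome of the round for the given content of the slots
  set out : Fin d × (Fin k → Fin d) → Outcome (Memory d k) × Outcome (Memory d k) := fun q =>
    let b := loadedLabel k x q
    let p := dot w (decode b)
    let w' := hingeStep η θ g w (decode b) (E.label t (τ.reports t) p) p
    ((p, b), (maskedNorm θ w' w', default)) with hout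
  -- Different slot contents give different outcomes, so the sum over all outcomes is at least the
  -- finite sum over these.
  have hinj : Function.Injective out := fun q q' h =>
    (loadedLabel k x).injective (congrArg (fun o => o.1.2) h)
  refine le_trans ?_ (ENNReal.tsum_comp_le_tsum_of_injective hinj _)
  rw [tsum_fintype]
  have hterm : ∀ q, ENNReal.ofReal (if ∀ j ∈ Finset.univ.filter m, ∃ i, q.2 i = j then
      ‖a‖ ^ 2 * (1 / d * ∏ i, groverAmp m n (q.2 i) ^ 2) else 0) ≤
      if GoodRound E η θ g c t (Function.update τ t (out q)) then
        ‖A.branch E (Function.update τ t (out q)) (t + 1)‖ₑ ^ 2 else 0 := by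
    intro q
    by_cases hq : ∀ j ∈ Finset.univ.filter m, ∃ i, q.2 i = j
    swap
    · rw [if_neg hq, ENNReal.ofReal_zero]
      exact zero_le
    rw [if_pos hq]
    set τ' := Function.update τ t (out q) with hτ'
    have hcongr : ∀ i < t, τ i = τ' i := fun i hi => by
      rw [hτ', Function.update_of_ne hi.ne]
    have ht' : τ' t = out q := Function.update_self _ _ _
    have hw' : trackedWeight E η θ g τ' t = w := by
      rw [hw, trackedWeight, trackedWeight, records_congr E hcongr]
    have hx' : E.x τ' t = x := by rw [hx, E.x_congr hcongr]
    have hy' : E.y τ' t = E.label t (τ.reports t) (out q).1.1 := by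
      rw [Adversary.y, reports_congr hcongr, Transcript.pred, ht']
    have g1 : (τ' t).1.1 = dot (trackedWeight E η θ g τ' t) (decode (τ' t).1.2) := by
      rw [ht', hw']
    have g3 : (τ' t).2 = (maskedNorm θ (trackedWeight E η θ g τ' (t + 1))
        (trackedWeight E η θ g τ' (t + 1)), default) := by
      rw [trackedWeight_succ, hw', hy', ht']
    have g2 : Captures c (trackedWeight E η θ g τ' t) (E.x τ' t) (τ' t).1.2 := by
      rw [hw', hx', ht']
      exact ⟨fun i => rfl, fun j hj => hq j (Finset.mem_filter.2 ⟨Finset.mem_univ j, hj⟩)⟩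
    rw [if_pos ⟨g1, g2, g3⟩]
    have hbr : A.branch E τ' t = a • restState k (trackedWeight E η θ g τ' t) := by
      rw [← A.branch_congr E hcongr, ha, hw']
    obtain ⟨ψ, a', hψ, hna', hbr'⟩ := branch_succ E hbr g1 g3
    rw [hw', hx'] at hψ
    have hb : (τ' t).1.2 = loadedLabel k x q := by rw [ht']
    rw [hbr', enorm_smul, ← ofReal_norm (restState k _), norm_restState, ENNReal.ofReal_one,
      mul_one, ← ofReal_norm, ← ENNReal.ofReal_pow (norm_nonneg _), hna', mul_pow, hb,
      norm_sq_loadedLabel_of_isSearchState hψ]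
  refine le_trans ?_ (Finset.sum_le_sum fun q _ => hterm q)
  have hnn : ∀ q : Fin d × (Fin k → Fin d),
      0 ≤ if ∀ j ∈ Finset.univ.filter m, ∃ i, q.2 i = j then
        ‖a‖ ^ 2 * (1 / (d : ℝ) * ∏ i, groverAmp m n (q.2 i) ^ 2) else 0 := by
    intro q
    split_ifs
    · exact mul_nonneg (sq_nonneg _) (mul_nonneg (by positivity)
        (Finset.prod_nonneg fun i _ => sq_nonneg _))
    · exact le_rfl
  rw [← ENNReal.ofReal_sum_of_nonneg fun q _ => hnn q, ← ofReal_norm, hna,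
    ← ENNReal.ofReal_pow (norm_nonneg _), ← ENNReal.ofReal_mul' (sq_nonneg _)]
  refine ENNReal.ofReal_le_ofReal ?_
  have hd : (0 : ℝ) < d := by exact_mod_cast Nat.pos_of_ne_zero (NeZero.ne d)
  have hsum := one_sub_le_sum_prod (F := fun j => groverAmp m n j ^ 2) (fun j => sq_nonneg _)
    (sum_sq_groverAmp m n) (Finset.univ.filter m) (q := 1 / (8 * r))
    (fun j hj => by
      rw [hn]
      exact le_sq_groverAmp hr1 hcard (Finset.mem_filter.1 hj).2) k
  have hcard' : ((Finset.univ.filter m).card : ℝ) ≤ r := by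
    rw [Set.ncard_eq_toFinset_card', Set.toFinset_ofPred] at hcard
    exact_mod_cast hcard
  have hr0 : (1 : ℝ) ≤ r := by exact_mod_cast hr1
  have hq0 : (0 : ℝ) ≤ 1 - 1 / (8 * r) := by
    rw [sub_nonneg, div_le_one (by positivity)]
    linarith
  have hle : p ≤ ∑ a : Fin k → Fin d, if ∀ j ∈ Finset.univ.filter m, ∃ i, a i = j then
      ∏ i, groverAmp m n (a i) ^ 2 else 0 := by
    refine le_trans (hp.trans ?_) hsum
    gcongr
  have hfac : ∑ q : Fin d × (Fin k → Fin d),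
      (if ∀ j ∈ Finset.univ.filter m, ∃ i, q.2 i = j then
        ‖a‖ ^ 2 * (1 / (d : ℝ) * ∏ i, groverAmp m n (q.2 i) ^ 2) else 0)
      = ‖a‖ ^ 2 * ∑ a : Fin k → Fin d, if ∀ j ∈ Finset.univ.filter m, ∃ i, a i = j then
      ∏ i, groverAmp m n (a i) ^ 2 else 0 := by
    rw [Fintype.sum_prod_type]
    simp only [Finset.sum_const, Finset.card_univ, Fintype.card_fin, nsmul_eq_mul]
    rw [Finset.mul_sum, Finset.mul_sum]
    refine Finset.sum_congr rfl fun a' _ => ?_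
    split_ifs
    · field_simp
    · simp
  rw [hfac, mul_comm]
  gcongr

end Learner

/-! ### Choice of the parameters -/

/-- The number of slots that suffices for error probability `δ / T` per round. -/
theorem miss_probability_le {r T : ℕ} {δ : ℝ} (hr : 1 ≤ r) (hT : 1 ≤ T) (hδ : 0 < δ) :
    (r : ℝ) * (1 - 1 / (8 * r)) ^ ⌈8 * (r : ℝ) * Real.log (r * T / δ)⌉₊ ≤ δ / T := by
  have hr0 : (1 : ℝ) ≤ r := by exact_mod_cast hr
  have hT0 : (1 : ℝ) ≤ T := by exact_mod_cast hT
  set k := ⌈8 * (r : ℝ) * Real.log (r * T / δ)⌉₊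
  have hk : 8 * (r : ℝ) * Real.log (r * T / δ) ≤ k := Nat.le_ceil _
  have hq0 : (0 : ℝ) ≤ 1 - 1 / (8 * r) := by
    rw [sub_nonneg, div_le_one (by positivity)]
    linarith
  have h1 : (1 - 1 / (8 * (r : ℝ))) ^ k ≤ Real.exp (-(k / (8 * r))) := by
    have h : 1 - 1 / (8 * (r : ℝ)) ≤ Real.exp (-(1 / (8 * r))) := by
      have := Real.add_one_le_exp (-(1 / (8 * (r : ℝ))))
      linarith
    calc _ ≤ Real.exp (-(1 / (8 * r))) ^ k := by gcongr
      _ = _ := by rw [← Real.exp_nat_mul]; congr 1; ring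
  have h2 : Real.exp (-(k / (8 * r))) ≤ δ / (r * T) := by
    rw [← Real.le_log_iff_exp_le (by positivity), ← inv_div (r * T : ℝ) δ, Real.log_inv, neg_le_neg_iff,
      le_div_iff₀ (by positivity), mul_comm]
    exact hk
  calc (r : ℝ) * (1 - 1 / (8 * r)) ^ k ≤ r * (δ / (r * T)) := by
        gcongr
        exact h1.trans h2
    _ = δ / T := by field_simp

/-- `k` is of order `T * log (T / δ)` and `2 * n + 1 ≤ 3 * √d`, so even `T ^ 2` suffices in place of
`T ^ (5 / 2)`. Since `T / δ ≥ 2`, the logarithm is at least `log 2`, which absorbs `log m` and the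
rounding of `k`. -/
theorem query_count_le {d T m k n : ℕ} {δ : ℝ} (hd : 1 ≤ d) (hT : 2 ≤ T) (hm : 1 ≤ m)
    (hδ : 0 < δ) (hδ1 : δ < 1)
    (hk : k = ⌈8 * ((m * T : ℕ) : ℝ) * Real.log ((m * T : ℕ) * T / δ)⌉₊)
    (hn : n = Nat.sqrt (d / (8 * (m * T)))) :
    ((T * (k * (2 * n + 1)) : ℕ) : ℝ)
      ≤ 3 * (8 * m * (Real.log m / Real.log 2 + 2) + 2) *
        ((T : ℝ) ^ (5 / 2 : ℝ) * Real.sqrt d * Real.log (T / δ)) := by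
  have hT0 : (2 : ℝ) ≤ T := by exact_mod_cast hT
  have hm0 : (1 : ℝ) ≤ m := by exact_mod_cast hm
  have hd0 : (1 : ℝ) ≤ d := by exact_mod_cast hd
  have hl2 : (1 / 2 : ℝ) ≤ Real.log 2 := by linarith [Real.log_two_gt_d9]
  set L := Real.log (T / δ) with hL
  have hL2 : Real.log 2 ≤ L := by
    refine Real.log_le_log (by norm_num) ?_
    rw [le_div_iff₀ hδ]
    nlinarith
  have hlm : 0 ≤ Real.log m := Real.log_nonneg hm0
  have hlog : Real.log ((m * T : ℕ) * T / δ) ≤ (Real.log m / Real.log 2 + 2) * L := by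
    have h1 : Real.log ((m * T : ℕ) * T / δ) = Real.log m + Real.log T + L := by
      rw [hL, mul_div_assoc, Real.log_mul (by positivity) (by positivity), Nat.cast_mul,
        Real.log_mul (by positivity) (by positivity)]
    have h2 : Real.log T ≤ L := by
      refine Real.log_le_log (by positivity) ?_
      rw [le_div_iff₀ hδ]
      nlinarith
    have h3 : Real.log m ≤ Real.log m / Real.log 2 * L := by
      rw [div_mul_eq_mul_div, le_div_iff₀ (by linarith)]
      gcongr
    linarith
  have hkle : (k : ℝ) ≤ (8 * m * (Real.log m / Real.log 2 + 2) + 2) * (T * L) := by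
    have h0 : 0 ≤ Real.log ((m * T : ℕ) * T / δ) := by
      refine Real.log_nonneg ?_
      rw [le_div_iff₀ hδ, one_mul]
      push_cast
      have h1 : (1 : ℝ) ≤ m * T := by nlinarith
      nlinarith
    have h1 : (k : ℝ) < 8 * ((m * T : ℕ) : ℝ) * Real.log ((m * T : ℕ) * T / δ) + 1 := by
      rw [hk]
      exact Nat.ceil_lt_add_one (by positivity)
    have h2 : 8 * ((m * T : ℕ) : ℝ) * Real.log ((m * T : ℕ) * T / δ)
        ≤ 8 * ((m * T : ℕ) : ℝ) * ((Real.log m / Real.log 2 + 2) * L) := by gcongr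
    have h3 : 1 ≤ 2 * (T * L) := by nlinarith
    push_cast at h1 h2
    nlinarith
  have hnle : 2 * (n : ℝ) + 1 ≤ 3 * Real.sqrt d := by
    have h1 : n * n ≤ d := by
      rw [hn]
      exact (Nat.sqrt_le _).trans (Nat.div_le_self _ _)
    have h2 : (n : ℝ) ≤ Real.sqrt d := Real.le_sqrt_of_sq_le (by rw [sq]; exact_mod_cast h1)
    have h3 : 1 ≤ Real.sqrt d := Real.one_le_sqrt.2 hd0
    linarith
  have hTpow : (T : ℝ) * T ≤ (T : ℝ) ^ (5 / 2 : ℝ) := by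
    rw [← sq, ← Real.rpow_natCast]
    exact Real.rpow_le_rpow_of_exponent_le (by linarith) (by norm_num)
  have hL0 : 0 ≤ L := by linarith
  have hc0 : 0 ≤ 8 * m * (Real.log m / Real.log 2 + 2) + 2 := by positivity
  push_cast
  calc (T : ℝ) * (k * (2 * n + 1))
      ≤ T * ((8 * m * (Real.log m / Real.log 2 + 2) + 2) * (T * L) * (3 * Real.sqrt d)) := by
        gcongr
    _ = 3 * (8 * m * (Real.log m / Real.log 2 + 2) + 2) * (T * T * Real.sqrt d * L) := by ring
    _ ≤ _ := by gcongr

/-- If all rounds are good, the learner is correct. -/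
theorem correct_of_goodRound {d k n : ℕ} [NeZero d] {η θ g c C εIP εnorm : ℝ} {E : Adversary d}
    (hE : E.Admissible C) (hη : 0 < η) (hc : 0 < c) (hcg : c ≤ g) (hcθ : η * c ≤ θ) {T : ℕ}
    (hT : 1 ≤ T) (hε : 0 ≤ εIP) (hε' : 0 ≤ εnorm) {τ : Transcript (Memory d k)}
    (hτ : ∀ s < T, GoodRound E η θ g c s τ) :
    (sparseLearner d k n η θ g c).Correct E T η θ g εIP εnorm τ := by
  have hw : ∀ t ≤ T, trackedWeight E η θ g τ t
      = weight η θ (fun _ => g) (E.x τ) (E.y τ) τ.pred t := fun t ht =>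
    (trackedWeight_eq_weight E hE hη hc hcg hcθ fun s hs => hτ s (by omega)).1
  refine ⟨?_, fun t ht => ⟨?_, ?_⟩, fun t ht hne => ?_⟩
  · refine (hτ 0 hT).1.trans ?_
    change dot (0 : EuclideanSpace ℝ (Fin d)) _ = 0
    simp [dot]
  · obtain ⟨h1, h2, -⟩ := hτ t ht
    rw [h2.dot_decode, hw t ht.le] at h1
    rw [Transcript.pred, h1, sub_self, abs_zero]
    exact hε
  · obtain ⟨-, -, h3⟩ := hτ t ht
    rw [hw (t + 1) ht] at h3
    rw [Transcript.est, h3, sub_self, abs_zero]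
    exact hε'
  · obtain ⟨a, ha⟩ := exists_branch_eq (n := n) E fun s (hs : s < t + 1) => hτ s (by omega)
    rw [hw (t + 1) ht, restState, if_neg hne] at ha
    rw [ha]
    exact prepared_smul_weightState a _

/-- Bernoulli's inequality, for `T` rounds with failure probability `δ / T` each. -/
theorem ofReal_one_sub_le_pow {T : ℕ} (hT : 1 ≤ T) {δ : ℝ} (hδ1 : δ < 1) :
    ENNReal.ofReal (1 - δ) ≤ ENNReal.ofReal (1 - δ / T) ^ T := by
  have hT0 : (1 : ℝ) ≤ T := by exact_mod_cast hT
  have h1 : δ / T < 1 := by rw [div_lt_one (by linarith)]; linarith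
  rw [← ENNReal.ofReal_pow (by linarith)]
  refine ENNReal.ofReal_le_ofReal ?_
  have := one_add_mul_le_pow (a := -(δ / T)) (by linarith) T
  have h2 : (T : ℝ) * -(δ / T) = -δ := by field_simp
  rw [h2] at this
  simpa only [← sub_eq_add_neg] using this

end SparseOnline
end

/-! ### Assembly of the regret bound and the algorithm -/

open SparseOnline in
theorem theorem2 :
    -- The regret bound, for all estimates with the required accuracy.
    (∀ (C θ : ℝ) (d T : ℕ) (g : ℕ → ℝ) (gmax η : ℝ)
        (x : ℕ → EuclideanSpace ℝ (Fin d)) (y ytil qtil : ℕ → ℝ),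
      0 < C → 0 < θ → 1 ≤ T → η = 1 / (C ^ 2 * Real.sqrt T) →
      (∀ t < T, 0 ≤ g t ∧ g t ≤ gmax) →
      (∀ t < T, ‖x t‖ ≤ C) →
      (∀ t < T, y t = 1 ∨ y t = -1) →
      Accurate T η θ g x y ytil qtil (1 / (2 * Real.sqrt T)) (1 / (2 * η * T)) →
      ∀ u : EuclideanSpace ℝ (Fin d),
        hingeRegret T η θ g x y ytil qtil u
          ≤ (2 + C ^ 2 * (gmax + ‖u‖ ^ 2)) / (2 * Real.sqrt T)) ∧
    -- The quantum algorithm, with its success probability and its number of queries.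
    (∀ C θ g : ℝ, 0 < C → 0 < θ → 0 < g →
      ∃ K : ℝ, ∀ (d T : ℕ) (δ η : ℝ), 1 ≤ d → 2 ≤ T → 0 < δ → δ < 1 →
        η = 1 / (C ^ 2 * Real.sqrt T) →
        ∃ (W M : Type) (_ : Inhabited M) (A : Learner d W M),
          ∀ E : Adversary d, E.Admissible C →
            (∀ τ : Transcript M,
              (A.queries E τ T : ℝ)
                ≤ K * ((T : ℝ) ^ (5 / 2 : ℝ) * Real.sqrt d * Real.log (T / δ))) ∧
            ENNReal.ofReal (1 - δ) ≤
              A.prob E T fun τ =>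
                A.Correct E T η θ g (1 / (2 * Real.sqrt T))
                  (min (1 / (2 * Real.sqrt T)) (1 / (2 * η * T))) τ ∧
                ∀ u : EuclideanSpace ℝ (Fin d),
                  hingeRegret T η θ (fun _ => g) (E.x τ) (E.y τ) τ.pred τ.est u
                    ≤ (2 + C ^ 2 * (g + ‖u‖ ^ 2)) / (2 * Real.sqrt T)) := by
  refine ⟨fun C θ d T g gmax η x y ytil qtil hC hθ hT hη hg hx hy hacc u =>
    hingeRegret_le hC hθ hT hη hg hx hy hacc u, fun C θ g hC hθ hg => ?_⟩
  -- The bound `c ≤ g` lets the gravity win, and `c ≤ θ * C ^ 2` gives `η * c ≤ θ` because `√T ≥ 1`.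
  -- Neither involves `d`, `T` or `δ`, so `m` and the constant `K` do not either.
  obtain ⟨c, hc⟩ : ∃ c, c = min g (θ * C ^ 2) := ⟨_, rfl⟩
  have hc0 : 0 < c := by rw [hc]; exact lt_min hg (by positivity)
  have hcg : c ≤ g := by rw [hc]; exact min_le_left _ _
  obtain ⟨m, hm⟩ : ∃ m, m = ⌈C ^ 2 / c ^ 2⌉₊ := ⟨_, rfl⟩
  have hm1 : 1 ≤ m := by rw [hm]; exact Nat.ceil_pos.2 (by positivity)
  refine ⟨3 * (8 * m * (Real.log m / Real.log 2 + 2) + 2), fun d T δ η hd hT hδ hδ1 hη => ?_⟩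
  have : NeZero d := ⟨by omega⟩
  have hT0 : (2 : ℝ) ≤ T := by exact_mod_cast hT
  have hs1 : 1 ≤ Real.sqrt T := Real.one_le_sqrt.2 (by linarith)
  have hη0 : 0 < η := by rw [hη]; positivity
  have hcθ : η * c ≤ θ := by
    have h1 : c ≤ θ * C ^ 2 := by rw [hc]; exact min_le_right _ _
    rw [hη, one_div_mul_eq_div, div_le_iff₀ (by positivity)]
    have h2 : θ * C ^ 2 * 1 ≤ θ * C ^ 2 * Real.sqrt T := by gcongr
    linarith
  have hr1 : 1 ≤ m * T := Nat.mul_pos hm1 (by omega)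
  obtain ⟨k, hk⟩ : ∃ k, k = ⌈8 * ((m * T : ℕ) : ℝ) * Real.log ((m * T : ℕ) * T / δ)⌉₊ := ⟨_, rfl⟩
  obtain ⟨n, hn⟩ : ∃ n, n = Nat.sqrt (d / (8 * (m * T))) := ⟨_, rfl⟩
  refine ⟨Slots d k, Memory d k, inferInstance, sparseLearner d k n η θ g c, fun E hE =>
    ⟨fun τ => ?_, ?_⟩⟩
  · rw [queries_sparseLearner]
    exact query_count_le hd hT hm1 hδ hδ1 hk hn
  · have hp : 1 - δ / T ≤ 1 - ((m * T : ℕ) : ℝ) * (1 - 1 / (8 * ((m * T : ℕ) : ℝ))) ^ k := by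
      have := miss_probability_le hr1 (by omega : 1 ≤ T) hδ
      rw [← hk] at this
      linarith
    classical
    have hprob := (sparseLearner d k n η θ g c).pow_le_prob E T (GoodRound E η θ g c)
      (fun t τ τ' h => goodRound_congr E h) (ENNReal.ofReal (1 - δ / T))
      (fun t ht τ hτ => le_tsum_goodRound E hE hη0 hc0 hcg hcθ (by rw [hm]) hr1 hn hp ht hτ)
      le_rfl
    refine (ofReal_one_sub_le_pow (by omega) hδ1).trans (hprob.trans ?_)
    refine Learner.prob_mono _ _ _ fun τ hτ => ?_
    have hcor := correct_of_goodRound (n := n) hE hη0 hc0 hcg hcθ (by omega : 1 ≤ T)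
      (by positivity : (0 : ℝ) ≤ 1 / (2 * Real.sqrt T))
      (by positivity : (0 : ℝ) ≤ min (1 / (2 * Real.sqrt T)) (1 / (2 * η * T))) hτ
    refine ⟨hcor, fun u => ?_⟩
    refine hingeRegret_le hC hθ (by omega) hη (fun t _ => ⟨hg.le, le_rfl⟩) (fun t _ => hE.1 t _)
      (fun t _ => hE.2 t _ _) (fun t ht => ⟨(hcor.2.1 t ht).1, ?_⟩) u
    exact (hcor.2.1 t ht).2.trans (min_le_right _ _)
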